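/- There are universal constants $c_0,c_4,c_6,c_7>0$ such that the following holds. Let $D,N,M\ge 1$ and $K\ge 0$ be integers, $\sigma\ge 0$, $\varepsilon>0$, and let $\gamma^\natural\in\mathbb{R}_+^N$ be a deterministic vector with non-negative entries, with support $S^\natural=\{k:\gamma^\natural_k\ne 0\}$ of cardinality at most $K$. Write $\gamma^\natural_{\max}$ and $\gamma^\natural_{\min}$ for the largest and the smallest non-zero entry of $\gamma^\natural$ and $c_\gamma=\gamma^\natural_{\max}/\gamma^\natural_{\min}$ (for $\gamma^\natural=0$ the conclusion below is trivial). Let $\bm a_1,\dots,\bm a_N$ be i.i.d. random vectors drawn uniformly from the sphere of radius $\sqrt D$ in $\mathbb{C}^D$, and let $\bm A=[\bm a_1,\dots,\bm a_N]\in\mathbb{C}^{D\times N}$. Let $\bm H\in\mathbb{C}^{N\times M}$ and $\bm Z\in\mathbb{C}^{D\times M}$ be random matrices, independent of $\bm A$, whose entries are mutually independent and circularly symmetric complex Gaussian, the entries of $\bm H$ with law $\mathcal{CN}(0,1)$ and those of $\bm Z$ with law $\mathcal{CN}(0,\sigma^2)$. Put $$\bm Y=\bm A\,\mathrm{diag}\big(\sqrt{\gamma^\natural_1},\dots,\sqrt{\gamma^\natural_N}\big)\bm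 H+\bm Z,\qquad \widehat{\bm\Sigma}=\frac1M \bm Y\bm Y^*,\qquad \mathcal{Y}_k=\sum_{1\le i,j\le D}\overline{a_{k,i}}\,a_{k,j}\,\widehat\Sigma(i,j)\quad (k=1,\dots,N),$$ which are real numbers, and $$S^0=\Big\{k:\ \mathcal{Y}_k>\frac1N\sum_{i=1}^N\mathcal{Y}_i\Big\}.$$ If $$M\ge c_4\Big(c_\gamma K+\frac{\sigma^2}{\gamma^\natural_{\min}}\Big)^2\log\Big(\frac{(eD)^2}{\varepsilon}\Big)\quad\text{and}\quad K\le\min\Big\{\frac{c_6D}{c_\gamma\log(DN)},\ \frac{c_7N}{c_\gamma}\Big\},$$ then $$\mathbb{P}\big(S^\natural\subset S^0\big)\ge 1-\varepsilon-\frac{c_0}{D\sqrt D}.$$ -/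

import Mathlib

open MeasureTheory ProbabilityTheory

noncomputable section

/-- The uniform distribution on the sphere of radius `√D` in `ℂ^D`: the surface measure of the unit
sphere of the real Euclidean space underlying `ℂ^D`, normalized to total mass one and scaled. -/
def uniformSphere (D : ℕ) : Measure (EuclideanSpace ℂ (Fin D)) :=
  Measure.map
    (fun x : Metric.sphere (0 : EuclideanSpace ℂ (Fin D)) 1 =>
      Real.sqrt D • (x : EuclideanSpace ℂ (Fin D)))
    (((volume : Measure (EuclideanSpace ℂ (Fin D))).toSphere Set.univ)⁻¹ •
      (volume : Measure (EuclideanSpace ℂ (Fin D))).toSphere)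

/-- The circularly symmetric complex Gaussian law `𝒞𝒩(0, v)`: real and imaginary part are
independent centred real Gaussians of variance `v / 2`. -/
def complexGaussian (v : ℝ) : Measure ℂ :=
  Measure.map (fun p : ℝ × ℝ => (⟨p.1, p.2⟩ : ℂ))
    ((gaussianReal 0 (v / 2).toNNReal).prod (gaussianReal 0 (v / 2).toNNReal))

/-- The codebook matrix `A = [a₁, …, a_N] ∈ ℂ^{D × N}` with columns `a_k`. -/
def codebook {D N : ℕ} (a : Fin N → EuclideanSpace ℂ (Fin D)) : Matrix (Fin D) (Fin N) ℂ :=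
  Matrix.of fun i k => a k i

/-- The received signal `Y = A √Γ H + Z`, where `Γ = diag γ`. -/
def receivedSignal {D N M : ℕ} (a : Fin N → EuclideanSpace ℂ (Fin D)) (γ : Fin N → ℝ)
    (H : Matrix (Fin N) (Fin M) ℂ) (Z : Matrix (Fin D) (Fin M) ℂ) : Matrix (Fin D) (Fin M) ℂ :=
  codebook a * Matrix.diagonal (fun k => ((Real.sqrt (γ k) : ℝ) : ℂ)) * H + Z

/-- The sample covariance `(1 / M) Y Y*`. -/
def sampleCov {D M : ℕ} (Y : Matrix (Fin D) (Fin M) ℂ) : Matrix (Fin D) (Fin D) ℂ :=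
  ((M : ℂ)⁻¹) • (Y * Y.conjTranspose)

/-- The statistic `𝒴_k = ∑_{i,j} conj(a_{k,i}) a_{k,j} Σ̂(i,j)` as a complex number; it is always
real, see `statC_im`. -/
def statC {D N M : ℕ} (a : Fin N → EuclideanSpace ℂ (Fin D)) (Y : Matrix (Fin D) (Fin M) ℂ)
    (k : Fin N) : ℂ :=
  ∑ i, ∑ j, starRingEnd ℂ (a k i) * a k j * sampleCov Y i j

theorem statC_im {D N M : ℕ} (a : Fin N → EuclideanSpace ℂ (Fin D))
    (Y : Matrix (Fin D) (Fin M) ℂ) (k : Fin N) : (statC a Y k).im = 0 := by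
  rw [← Complex.conj_eq_iff_im]
  unfold statC sampleCov
  simp only [map_sum, map_mul, Matrix.smul_apply, Matrix.mul_apply, Matrix.conjTranspose_apply,
    smul_eq_mul, map_inv₀, map_natCast, Complex.conj_conj, RCLike.star_def]
  rw [Finset.sum_comm]
  refine Finset.sum_congr rfl fun i _ => Finset.sum_congr rfl fun j _ => ?_
  have h : ∑ x, starRingEnd ℂ (Y j x) * Y i x = ∑ x, Y i x * starRingEnd ℂ (Y j x) :=
    Finset.sum_congr rfl fun x _ => mul_comm _ _
  rw [h]
  ring

/-- The statistic `𝒴_k` as a real number. -/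
def stat {D N M : ℕ} (a : Fin N → EuclideanSpace ℂ (Fin D)) (Y : Matrix (Fin D) (Fin M) ℂ)
    (k : Fin N) : ℝ :=
  (statC a Y k).re

/-- The first-stage set `S⁰ = {k : 𝒴_k > ρ * mean(𝒴)}`. -/
def firstStageSet {D N M : ℕ} (ρ : ℝ) (a : Fin N → EuclideanSpace ℂ (Fin D))
    (Y : Matrix (Fin D) (Fin M) ℂ) : Set (Fin N) :=
  {k | stat a Y k > ρ * ((1 / (N : ℝ)) * ∑ i, stat a Y i)}

/-- The largest entry of `γ` on its support. -/
def gammaMax {N : ℕ} (γ : Fin N → ℝ) : ℝ := sSup (γ '' Function.support γ)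

/-- The smallest entry of `γ` on its support. -/
def gammaMin {N : ℕ} (γ : Fin N → ℝ) : ℝ := sInf (γ '' Function.support γ)

/-- The dynamic range `c_γ = γ_max / γ_min` of the nonzero entries of `γ`. -/
def dynRange {N : ℕ} (γ : Fin N → ℝ) : ℝ := gammaMax γ / gammaMin γ

/-- The random model: the codewords `a_k` are i.i.d. uniform on the sphere of radius `√D` in `ℂ^D`,
the entries of the channel matrix `H` are `𝒞𝒩(0, 1)`, those of the noise matrix `Z` are
`𝒞𝒩(0, σ²)`, all the entries of `H` and `Z` are mutually independent, and the codewords are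
independent of `(H, Z)`. -/
structure IsSparcModel {Ω : Type*} [MeasurableSpace Ω] (P : Measure Ω) {D N M : ℕ} (σ : ℝ)
    (a : Fin N → Ω → EuclideanSpace ℂ (Fin D)) (H : Fin N → Fin M → Ω → ℂ)
    (Z : Fin D → Fin M → Ω → ℂ) : Prop where
  measurable_a : ∀ k, Measurable (a k)
  measurable_H : ∀ k m, Measurable (H k m)
  measurable_Z : ∀ i m, Measurable (Z i m)
  law_a : ∀ k, P.map (a k) = uniformSphere D
  law_H : ∀ k m, P.map (H k m) = complexGaussian 1
  law_Z : ∀ i m, P.map (Z i m) = complexGaussian (σ ^ 2)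
  indep_a : iIndepFun a P
  indep_HZ : iIndepFun
    (Sum.elim (fun q : Fin N × Fin M => H q.1 q.2) (fun q : Fin D × Fin M => Z q.1 q.2)) P
  indep_a_HZ : IndepFun (fun ω k => a k ω)
    (fun ω => ((fun k m => H k m ω : Fin N → Fin M → ℂ), (fun i m => Z i m ω : Fin D → Fin M → ℂ))) P

end

/-! Fix the codebook. Then `M * 𝒴_k` is the squared norm of the vector of correlations of `a_k` with
the `M` columns of `Y`. These correlations are i.i.d. circular Gaussians whose common variance `v_k`
is `statMean`, so `M * 𝒴_k` has the exponential moments `(1 - s * v_k)⁻¹ ^ M`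
(`exp_mul_stat_receivedSignal`). Chernoff bounds keep `𝒴_k` above `(1 - δ) * v_k` on the support,
and the average of all `𝒴_k` below `1 + δ` times a strict upper bound of the average variance. The
statistics are dependent across `k`; convexity of `exp` replaces independence in the second bound.

It remains to separate the variances. A word in the support has `v_k ≥ γ_min D² + σ² D` from its own
term. In the average, own terms contribute only `D² ∑ γ / N`, cross terms at most `μ ∑ γ` if all
relevant squared inner products are at most `μ`, and the noise again `σ² D`. The two bounds on `K`
make the first two at most `γ_min D² / 8` each, so a relative accuracy `δ` of order `1 / (1 + σ² /
γ_min)` suffices.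

Incoherence with `μ = 12 D log (DN)` holds outside an event of probability `O(D^(-3/2))`, by a union
bound over pairs and a tail bound on the sphere. That tail comes from comparison with a Gaussian
vector: in polar coordinates, Jensen's inequality in the radius bounds the spherical exponential
moment by the Gaussian one (`lintegral_toSphere_exp_sq_inner_le`). Fubini combines the codebook
event with the bound for fixed codebooks. -/

open Real in
theorem lintegral_exp_neg_mul_sq_norm {V : Type*} [NormedAddCommGroup V] [InnerProductSpace ℝ V]
    [FiniteDimensional ℝ V] [MeasurableSpace V] [BorelSpace V] {b : ℝ} (hb : 0 < b) :
    ∫⁻ v : V, ENNReal.ofReal (exp (-b * ‖v‖ ^ 2)) =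
      ENNReal.ofReal ((π / b) ^ (Module.finrank ℝ V / 2 : ℝ)) := by
  have h := GaussianFourier.integral_rexp_neg_mul_sq_norm (V := V) hb
  rw [← h, ofReal_integral_eq_lintegral_ofReal]
  -- A non-integrable function has Bochner integral zero, so a positive value of the integral forces
  -- integrability.
  · by_contra hn
    rw [integral_undef hn] at h
    have : 0 < (π / b) ^ (Module.finrank ℝ V / 2 : ℝ) := by positivity
    linarith
  · exact Filter.Eventually.of_forall fun _ => (exp_pos _).le

/-- Dropping the negative part only increases the integral. This serves the tangent-line minorant in
`exp_mul_lintegral_radial_le`, which may change sign. -/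
theorem ofReal_integral_le_lintegral_ofReal {α : Type*} [MeasurableSpace α] {μ : Measure α}
    {f : α → ℝ} (hf : Integrable f μ) :
    ENNReal.ofReal (∫ x, f x ∂μ) ≤ ∫⁻ x, ENNReal.ofReal (f x) ∂μ := by
  rw [← ENNReal.ofReal_toReal hf.lintegral_lt_top.ne]
  refine ENNReal.ofReal_le_ofReal ?_
  rw [integral_eq_lintegral_pos_part_sub_lintegral_neg_part hf]
  exact sub_le_self _ ENNReal.toReal_nonneg

/-! ### Exponential moments on the sphere by comparison with a Gaussian. -/

section SphereMoment

variable {E : Type*} [NormedAddCommGroup E] [InnerProductSpace ℝ E] [FiniteDimensional ℝ E]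
  [MeasurableSpace E] [BorelSpace E]

open Real in
theorem lintegral_exp_neg_sq_norm_add_sq_inner {u : E} (hu : ‖u‖ = 1) {l : ℝ} (hl : l < 1) :
    ∫⁻ x : E, ENNReal.ofReal (exp (-‖x‖ ^ 2 + l * inner ℝ u x ^ 2)) =
      ENNReal.ofReal ((1 - l)⁻¹ ^ (1 / 2 : ℝ)) *
        ∫⁻ x : E, ENNReal.ofReal (exp (-‖x‖ ^ 2)) := by
  set W : Submodule ℝ E := Submodule.span ℝ {u} with hW
  have hu0 : u ≠ 0 := by rintro rfl; simp at hu
  -- Along `E = ℝu ⊕ uᗮ` the integrand factors, with coefficient `c` instead of `1` in the direction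
  -- `u`. The lemma is the ratio of the cases `c = 1 - l` and `c = 1`.
  have key : ∀ c : ℝ, 0 < c →
      ∫⁻ x : E, ENNReal.ofReal (exp (-‖x‖ ^ 2 + (1 - c) * inner ℝ u x ^ 2)) =
      ENNReal.ofReal ((π / c) ^ (1 / 2 : ℝ)) *
        ENNReal.ofReal ((π / 1) ^ (Module.finrank ℝ Wᗮ / 2 : ℝ)) := by
    intro c hc
    have mp := (WithLp.volume_preserving_symm_measurableEquiv_toLp_prod W Wᗮ).comp
      W.orthogonalDecomposition.measurePreserving
    have e1 : ∀ x : E, ENNReal.ofReal (exp (-‖x‖ ^ 2 + (1 - c) * inner ℝ u x ^ 2)) =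
        (fun p : W × Wᗮ => ENNReal.ofReal (exp (-c * ‖p.1‖ ^ 2)) *
          ENNReal.ofReal (exp (-1 * ‖p.2‖ ^ 2)))
          (((MeasurableEquiv.toLp 2 (W × Wᗮ)).symm ∘ W.orthogonalDecomposition) x) := by
      intro x
      have h1 : ‖x‖ ^ 2 = ‖(W.orthogonalProjectionOnto x : W)‖ ^ 2
          + ‖(Wᗮ.orthogonalProjectionOnto x : Wᗮ)‖ ^ 2 := by
        exact Submodule.norm_sq_eq_add_norm_sq_projection x W
      have h2 : inner ℝ u x ^ 2 = ‖(W.orthogonalProjectionOnto x : W)‖ ^ 2 := by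
        change _ = ‖W.starProjection x‖ ^ 2
        rw [Submodule.starProjection_unit_singleton ℝ hu, norm_smul, hu, mul_one,
          Real.norm_eq_abs, sq_abs]
      simp only [Function.comp_apply, Submodule.orthogonalDecomposition_apply]
      rw [← ENNReal.ofReal_mul (exp_pos _).le, ← Real.exp_add, h1, h2]
      congr 2
      simp
      ring
    simp_rw [e1]
    rw [mp.lintegral_comp (f := fun p : W × Wᗮ => ENNReal.ofReal (exp (-c * ‖p.1‖ ^ 2)) *
          ENNReal.ofReal (exp (-1 * ‖p.2‖ ^ 2))) (by fun_prop), Measure.volume_eq_prod,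
      lintegral_prod_mul (f := fun w : W => ENNReal.ofReal (exp (-c * ‖w‖ ^ 2)))
        (g := fun w : Wᗮ => ENNReal.ofReal (exp (-1 * ‖w‖ ^ 2))) (by fun_prop) (by fun_prop),
      lintegral_exp_neg_mul_sq_norm hc,
      lintegral_exp_neg_mul_sq_norm one_pos, hW, finrank_span_singleton hu0]
    simp
  have h1 := key (1 - l) (by linarith)
  have h2 := key 1 one_pos
  simp only [sub_sub_cancel, sub_self, zero_mul, add_zero] at h1 h2
  have hl' : 0 < 1 - l := by linarith
  rw [h1, h2, ← mul_assoc, ← ENNReal.ofReal_mul (p := (1 - l)⁻¹ ^ (1 / 2 : ℝ)) (by positivity)]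
  congr 2
  rw [div_one, ← Real.mul_rpow (by positivity) pi_pos.le]
  ring_nf

theorem lintegral_eq_lintegral_toSphere (μ : Measure E) [μ.IsAddHaarMeasure] [Nontrivial E]
    {f : E → ENNReal} (hf : Measurable f) :
    ∫⁻ x, f x ∂μ = ∫⁻ θ, ∫⁻ r, f (r.1 • θ.1)
      ∂(Measure.volumeIoiPow (Module.finrank ℝ E - 1)) ∂μ.toSphere := by
  have hm : Measurable fun p : Metric.sphere (0 : E) 1 × Set.Ioi (0 : ℝ) => f (p.2.1 • p.1.1) := by
    fun_prop
  rw [← lintegral_prod _ hm.aemeasurable,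
    ← (μ.measurePreserving_homeomorphUnitSphereProd).lintegral_comp hm]
  have : ∀ x : ({0}ᶜ : Set E), f (((homeomorphUnitSphereProd E) x).2.1 •
      ((homeomorphUnitSphereProd E) x).1.1) = f x.1 := by
    intro x
    congr 1
    have hx : ‖x.1‖ ≠ 0 := norm_ne_zero_iff.2 x.2
    simp [smul_smul, hx]
  simp_rw [this]
  rw [lintegral_subtype_comap (measurableSet_singleton _).compl, restrict_compl_singleton]

theorem lintegral_volumeIoiPow (n : ℕ) {g : ℝ → ENNReal} (hg : Measurable g) :
    ∫⁻ r, g r.1 ∂(Measure.volumeIoiPow n) =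
      ∫⁻ r in Set.Ioi (0 : ℝ), ENNReal.ofReal (r ^ n) * g r := by
  rw [Measure.volumeIoiPow, lintegral_withDensity_eq_lintegral_mul _ (by fun_prop) (by fun_prop)]
  simp only [Pi.mul_apply]
  exact lintegral_subtype_comap measurableSet_Ioi (fun r : ℝ => ENNReal.ofReal (r ^ n) * g r)

open Real in
/-- Jensen's inequality for the radial part of a Gaussian vector in dimension `n + 1`,
whose squared radius has mean `(n + 1) / 2`. -/
theorem exp_mul_lintegral_radial_le (n : ℕ) (t : ℝ) :
    ENNReal.ofReal (exp (t * ((n + 1) / 2))) *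
        ∫⁻ r, ENNReal.ofReal (exp (-r.1 ^ 2)) ∂(Measure.volumeIoiPow n) ≤
      ∫⁻ r, ENNReal.ofReal (exp (-r.1 ^ 2 + t * r.1 ^ 2)) ∂(Measure.volumeIoiPow n) := by
  rw [lintegral_volumeIoiPow n (g := fun r => ENNReal.ofReal (exp (-r ^ 2))) (by fun_prop),
    lintegral_volumeIoiPow n (g := fun r => ENNReal.ofReal (exp (-r ^ 2 + t * r ^ 2)))
      (by fun_prop)]
  have hmoment : ∀ m : ℕ, IntegrableOn (fun r : ℝ => r ^ m * exp (-r ^ 2)) (Set.Ioi 0) ∧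
      ∫ r in Set.Ioi (0 : ℝ), r ^ m * exp (-r ^ 2) = 1 / 2 * Gamma ((m + 1) / 2) := by
    intro m
    have h := integral_rpow_mul_exp_neg_rpow (p := 2) (q := m) (by norm_num)
      (by have : (0 : ℝ) ≤ m := by positivity
          linarith)
    have hh : ∫ r in Set.Ioi (0 : ℝ), r ^ m * exp (-r ^ 2) = 1 / 2 * Gamma ((m + 1) / 2) := by
      rw [← h]
      simp
    refine ⟨?_, hh⟩
    by_contra hn
    rw [IntegrableOn] at hn
    rw [integral_undef hn] at hh
    have : 0 < Gamma (((m : ℝ) + 1) / 2) := Gamma_pos_of_pos (by positivity)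
    linarith
  obtain ⟨i0, e0⟩ := hmoment n
  obtain ⟨i2, e2⟩ := hmoment (n + 2)
  have hG : Gamma (((n + 2 : ℕ) + 1 : ℝ) / 2) = ((n : ℝ) + 1) / 2 * Gamma (((n : ℝ) + 1) / 2) := by
    rw [← Gamma_add_one (by positivity)]
    congr 1
    push_cast
    ring
  have hpos : ∀ᵐ r ∂(volume.restrict (Set.Ioi (0 : ℝ))), 0 ≤ r ^ n * exp (-r ^ 2) := by
    filter_upwards [ae_restrict_mem measurableSet_Ioi] with r hr
    have : 0 < r := hr
    positivity
  have eL : ∫⁻ r in Set.Ioi (0 : ℝ), ENNReal.ofReal (r ^ n) * ENNReal.ofReal (exp (-r ^ 2)) =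
      ENNReal.ofReal (∫ r in Set.Ioi (0 : ℝ), r ^ n * exp (-r ^ 2)) := by
    rw [ofReal_integral_eq_lintegral_ofReal i0 hpos]
    refine setLIntegral_congr_fun measurableSet_Ioi fun r hr => ?_
    have : (0 : ℝ) < r := hr
    rw [ENNReal.ofReal_mul (by positivity)]
  set m : ℝ := ((n : ℝ) + 1) / 2 with hm
  -- The tangent line of `exp` at the mean `m` of `r²` gives `exp (t * r²) ≥ exp (t * m) * (1 + t *
  -- (r² - m))`. The linear term integrates to zero by `hG`.
  have i3 : IntegrableOn (fun r : ℝ => exp (t * m) * ((1 - t * m) * (r ^ n * exp (-r ^ 2))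
      + t * (r ^ (n + 2) * exp (-r ^ 2)))) (Set.Ioi 0) :=
    ((i0.const_mul _).add (i2.const_mul _)).const_mul _
  have e3 : ∫ r in Set.Ioi (0 : ℝ), exp (t * m) * ((1 - t * m) * (r ^ n * exp (-r ^ 2))
      + t * (r ^ (n + 2) * exp (-r ^ 2))) =
      exp (t * m) * ∫ r in Set.Ioi (0 : ℝ), r ^ n * exp (-r ^ 2) := by
    rw [integral_const_mul, integral_add (i0.const_mul _) (i2.const_mul _), integral_const_mul,
      integral_const_mul, e0, e2, hG]
    ring
  rw [eL, ← ENNReal.ofReal_mul (exp_pos _).le, ← e3]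
  refine (ofReal_integral_le_lintegral_ofReal i3).trans ?_
  refine setLIntegral_mono (by fun_prop) fun r hr => ?_
  have hr0 : (0 : ℝ) < r := hr
  rw [← ENNReal.ofReal_mul (by positivity)]
  refine ENNReal.ofReal_le_ofReal ?_
  have hx := Real.add_one_le_exp (t * (r ^ 2 - m))
  have h4 : exp (-r ^ 2 + t * r ^ 2) = exp (-r ^ 2) * (exp (t * m) * exp (t * (r ^ 2 - m))) := by
    rw [← exp_add, ← exp_add]
    ring_nf
  rw [h4]
  have h5 : 0 ≤ r ^ n * (exp (-r ^ 2) * exp (t * m)) := by positivity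
  calc _ = r ^ n * (exp (-r ^ 2) * exp (t * m)) * (t * (r ^ 2 - m) + 1) := by ring
    _ ≤ r ^ n * (exp (-r ^ 2) * exp (t * m)) * exp (t * (r ^ 2 - m)) :=
        mul_le_mul_of_nonneg_left hx h5
    _ = _ := by ring

open Real in
-- In polar coordinates the Gaussian moment has exponent `l * r² * ⟨u, θ⟩²`, and `r²` has mean
-- `finrank / 2`. Jensen in `r` for each `θ` bounds it below by the spherical moment times the
-- radial mass `C`, which then cancels.
theorem lintegral_toSphere_exp_sq_inner_le [Nontrivial E] {u : E} (hu : ‖u‖ = 1) {l : ℝ}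
    (hl : l < 1) :
    ∫⁻ θ, ENNReal.ofReal (exp (l * (Module.finrank ℝ E / 2) * inner ℝ u θ.1 ^ 2))
        ∂(volume : Measure E).toSphere ≤
      ENNReal.ofReal ((1 - l)⁻¹ ^ (1 / 2 : ℝ)) * (volume : Measure E).toSphere Set.univ := by
  set C := ∫⁻ r, ENNReal.ofReal (exp (-r.1 ^ 2))
    ∂(Measure.volumeIoiPow (Module.finrank ℝ E - 1)) with hC
  have hd : 0 < Module.finrank ℝ E := Module.finrank_pos
  have hnorm : ∀ (r : Set.Ioi (0 : ℝ)) (θ : Metric.sphere (0 : E) 1), ‖r.1 • θ.1‖ = r.1 := by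
    intro r θ
    have : 0 < r.1 := r.2
    have hθ : ‖θ.1‖ = 1 := by simp
    rw [norm_smul, hθ, mul_one, Real.norm_eq_abs, abs_of_pos this]
  have h0 : ∫⁻ x : E, ENNReal.ofReal (exp (-‖x‖ ^ 2)) =
      C * (volume : Measure E).toSphere Set.univ := by
    rw [lintegral_eq_lintegral_toSphere volume (by fun_prop)]
    simp_rw [hnorm]
    rw [lintegral_const]
  have hfin : ∫⁻ x : E, ENNReal.ofReal (exp (-‖x‖ ^ 2)) ≠ ⊤ ∧
      ∫⁻ x : E, ENNReal.ofReal (exp (-‖x‖ ^ 2)) ≠ 0 := by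
    have := lintegral_exp_neg_mul_sq_norm (V := E) one_pos
    simp only [neg_mul, one_mul] at this
    rw [this]
    refine ⟨ENNReal.ofReal_ne_top, ?_⟩
    have : 0 < (π / 1) ^ (Module.finrank ℝ E / 2 : ℝ) := by positivity
    simpa using this
  rw [h0] at hfin
  have hC0 : C ≠ 0 := fun h => hfin.2 (by rw [h, zero_mul])
  have hCt : C ≠ ⊤ := by
    intro h
    refine hfin.1 ?_
    rw [h, ENNReal.top_mul]
    intro h'
    exact hfin.2 (by rw [h', mul_zero])
  have h1 := lintegral_exp_neg_sq_norm_add_sq_inner hu hl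
  rw [h0, lintegral_eq_lintegral_toSphere volume (by fun_prop)] at h1
  have h2 : (∫⁻ θ, ENNReal.ofReal (exp (l * (Module.finrank ℝ E / 2) * inner ℝ u θ.1 ^ 2))
        ∂(volume : Measure E).toSphere) * C ≤
      (ENNReal.ofReal ((1 - l)⁻¹ ^ (1 / 2 : ℝ)) * (volume : Measure E).toSphere Set.univ) * C := by
    rw [mul_assoc, mul_comm (Measure.toSphere _ _) C, ← h1, ← lintegral_mul_const _ (by fun_prop)]
    refine lintegral_mono fun θ => ?_
    have h3 := exp_mul_lintegral_radial_le (Module.finrank ℝ E - 1) (l * inner ℝ u θ.1 ^ 2)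
    have hc : ((Module.finrank ℝ E - 1 : ℕ) : ℝ) + 1 = Module.finrank ℝ E := by
      exact_mod_cast Nat.sub_add_cancel hd
    rw [hc] at h3
    refine (le_of_eq ?_).trans (h3.trans (le_of_eq ?_))
    · rw [hC]
      congr 3
      ring
    · refine lintegral_congr fun r => ?_
      rw [hnorm, inner_smul_right]
      congr 2
      ring
  exact (ENNReal.mul_le_mul_iff_left hC0 hCt).1 h2

end SphereMoment

/-! ### Circularly symmetric complex Gaussians and their exponential moments. -/

theorem measurable_complex_mk : Measurable fun p : ℝ × ℝ => (⟨p.1, p.2⟩ : ℂ) :=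
  Complex.measurableEquivRealProd.symm.measurable

instance isProbabilityMeasure_complexGaussian (v : ℝ) :
    IsProbabilityMeasure (complexGaussian v) :=
  Measure.isProbabilityMeasure_map measurable_complex_mk.aemeasurable

theorem charFun_complexGaussian {v : ℝ} (hv : 0 ≤ v) (t : ℂ) :
    charFun (complexGaussian v) t = Complex.exp (-(v * ‖t‖ ^ 2 / 4 : ℝ)) := by
  rw [charFun_apply, complexGaussian, integral_map measurable_complex_mk.aemeasurable (by
    exact Continuous.aestronglyMeasurable (by fun_prop))]
  have : ∀ p : ℝ × ℝ, Complex.exp ((inner ℝ (⟨p.1, p.2⟩ : ℂ) t : ℝ) * Complex.I) =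
      Complex.exp ((inner ℝ p.1 t.re : ℝ) * Complex.I) *
        Complex.exp ((inner ℝ p.2 t.im : ℝ) * Complex.I) := by
    intro p
    rw [← Complex.exp_add, ← add_mul, ← Complex.ofReal_add]
    congr 3
    simp [Complex.inner]
  simp_rw [this]
  rw [integral_prod_mul (fun x : ℝ => Complex.exp ((inner ℝ x t.re : ℝ) * Complex.I))
    (fun x : ℝ => Complex.exp ((inner ℝ x t.im : ℝ) * Complex.I)), ← charFun_apply,
    ← charFun_apply, charFun_gaussianReal, charFun_gaussianReal, ← Complex.exp_add]
  congr 1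
  rw [Real.coe_toNNReal _ (by positivity), ← Complex.normSq_eq_norm_sq, Complex.normSq_apply]
  push_cast
  ring

theorem map_mul_complexGaussian {v : ℝ} (hv : 0 ≤ v) (c : ℂ) :
    (complexGaussian v).map (fun z => c * z) = complexGaussian (‖c‖ ^ 2 * v) := by
  have : IsProbabilityMeasure ((complexGaussian v).map (fun z => c * z)) :=
    Measure.isProbabilityMeasure_map (by fun_prop)
  refine Measure.ext_of_charFun ?_
  ext t
  rw [charFun_complexGaussian (by positivity), charFun_apply, integral_map (by fun_prop)
    (Continuous.aestronglyMeasurable (by fun_prop))]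
  have : ∀ z : ℂ, (inner ℝ (c * z) t : ℝ) = inner ℝ z (starRingEnd ℂ c * t) := by
    intro z
    simp [Complex.inner]
    ring
  simp_rw [this]
  rw [← charFun_apply, charFun_complexGaussian hv]
  congr 1
  simp only [norm_mul, RCLike.norm_conj]
  push_cast
  ring

/-- A linear combination of independent circularly symmetric Gaussians is again one. -/
theorem map_sum_mul_complexGaussian {Ω ι : Type*} [MeasurableSpace Ω] {P : Measure Ω}
    [IsProbabilityMeasure P] [Fintype ι] {g : ι → Ω → ℂ} {v : ι → ℝ} (hv : ∀ j, 0 ≤ v j)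
    (hg : ∀ j, Measurable (g j)) (hlaw : ∀ j, P.map (g j) = complexGaussian (v j))
    (hind : iIndepFun g P) (c : ι → ℂ) :
    P.map (fun ω => ∑ j, c j * g j ω) = complexGaussian (∑ j, ‖c j‖ ^ 2 * v j) := by
  have hm : Measurable fun ω => ∑ j, c j * g j ω := by fun_prop
  have : IsProbabilityMeasure (P.map (fun ω => ∑ j, c j * g j ω)) :=
    Measure.isProbabilityMeasure_map (by fun_prop)
  refine Measure.ext_of_charFun ?_
  have hi : iIndepFun (fun j ω => c j * g j ω) P :=
    hind.comp (fun j z => c j * z) (fun j => by fun_prop)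
  rw [hi.charFun_map_fun_sum_eq_prod (fun j => by fun_prop)]
  ext t
  rw [charFun_complexGaussian (Finset.sum_nonneg fun j _ => mul_nonneg (by positivity) (hv j)),
    Finset.prod_apply]
  have : ∀ j, charFun (P.map (fun ω => c j * g j ω)) t =
      Complex.exp (-((‖c j‖ ^ 2 * v j) * ‖t‖ ^ 2 / 4 : ℝ)) := by
    intro j
    have : P.map (fun ω => c j * g j ω) = (P.map (g j)).map (fun z => c j * z) := by
      rw [Measure.map_map (by fun_prop) (hg j)]
      rfl
    rw [this, hlaw, map_mul_complexGaussian (hv j),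
      charFun_complexGaussian (mul_nonneg (by positivity) (hv j))]
  simp_rw [this]
  rw [← Complex.exp_sum]
  congr 1
  push_cast
  rw [Finset.sum_neg_distrib, Finset.sum_mul, Finset.sum_div]

open Real in
theorem integrable_exp_mul_sq_gaussianReal {v : NNReal} {s : ℝ} (hs : 2 * s * v < 1) :
    Integrable (fun x => exp (s * x ^ 2)) (gaussianReal 0 v) ∧
      ∫ x, exp (s * x ^ 2) ∂(gaussianReal 0 v) = (√(1 - 2 * s * v))⁻¹ := by
  -- The degenerate case does occur: without noise, a word orthogonal to all active words has
  -- conditional variance zero.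
  by_cases hv : v = 0
  · subst hv
    simp [gaussianReal_zero_var]
    exact integrable_dirac (by simp)
  have hv0 : (0 : ℝ) < v := by positivity
  have hb : 0 < (1 - 2 * s * v) / (2 * v) := by
    have : 0 < 1 - 2 * s * v := by linarith
    positivity
  have heq : ∀ x : ℝ, gaussianPDFReal 0 v x * exp (s * x ^ 2) =
      (√(2 * π * v))⁻¹ * exp (-((1 - 2 * s * v) / (2 * v)) * x ^ 2) := by
    intro x
    rw [gaussianPDFReal, mul_assoc, ← exp_add]
    congr 2
    field_simp
    ring
  constructor
  · rw [gaussianReal_of_var_ne_zero _ hv]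
    rw [integrable_withDensity_iff_integrable_smul' (by fun_prop) (by simp [gaussianPDF])]
    simp only [smul_eq_mul, toReal_gaussianPDF, heq]
    exact (integrable_exp_neg_mul_sq hb).const_mul _
  · rw [integral_gaussianReal_eq_integral_smul hv]
    simp only [smul_eq_mul, heq]
    rw [integral_const_mul, integral_gaussian, ← sqrt_inv, ← sqrt_inv,
      ← sqrt_mul (by positivity)]
    congr 1
    have : 0 < 1 - 2 * s * v := by linarith
    field_simp

open Real in
theorem exp_mul_sq_norm_complexGaussian {v s : ℝ} (hv : 0 ≤ v) (hs : s * v < 1) :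
    Integrable (fun z => exp (s * ‖z‖ ^ 2)) (complexGaussian v) ∧
      ∫ z, exp (s * ‖z‖ ^ 2) ∂(complexGaussian v) = (1 - s * v)⁻¹ := by
  have hw : 2 * s * ((v / 2).toNNReal : ℝ) = s * v := by
    rw [coe_toNNReal _ (by positivity)]
    ring
  obtain ⟨h1, h2⟩ := integrable_exp_mul_sq_gaussianReal (v := (v / 2).toNNReal) (s := s)
    (by rw [hw]; exact hs)
  have heq : ∀ p : ℝ × ℝ, exp (s * ‖(⟨p.1, p.2⟩ : ℂ)‖ ^ 2) =
      exp (s * p.1 ^ 2) * exp (s * p.2 ^ 2) := by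
    intro p
    rw [← exp_add, ← Complex.normSq_eq_norm_sq, Complex.normSq_apply]
    congr 1
    ring
  constructor
  · rw [complexGaussian, integrable_map_measure (Continuous.aestronglyMeasurable (by fun_prop))
      measurable_complex_mk.aemeasurable]
    simp only [Function.comp_def, heq]
    exact h1.mul_prod h1
  · rw [complexGaussian, integral_map measurable_complex_mk.aemeasurable
      (Continuous.aestronglyMeasurable (by fun_prop))]
    simp only [heq]
    rw [integral_prod_mul (fun x : ℝ => exp (s * x ^ 2)) (fun x : ℝ => exp (s * x ^ 2)), h2, hw,
      ← mul_inv, mul_self_sqrt (by linarith)]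

/-- A product measure over `ι × κ` is an iterated product. This turns independence of all entries
into independence of the columns. -/
theorem iIndepFun_curry {Ω ι κ α : Type*} [MeasurableSpace Ω] [MeasurableSpace α] {P : Measure Ω}
    {X : ι → κ → Ω → α} (mX : ∀ i j, Measurable (X i j))
    (h : iIndepFun (fun (p : ι × κ) ω => X p.1 p.2 ω) P) :
    iIndepFun (fun i ω j => X i j ω) P := by
  have := h.isProbabilityMeasure
  have : ∀ i j, IsProbabilityMeasure (P.map (X i j)) :=
    fun i j => Measure.isProbabilityMeasure_map (mX i j).aemeasurable
  rw [iIndepFun_iff_map_fun_eq_infinitePi_map (by fun_prop)]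
  have h1 : (fun ω i j => X i j ω) = (MeasurableEquiv.curry ι κ α) ∘ fun ω p => X p.1 p.2 ω := by
    ext
    rfl
  rw [h1, ← Measure.map_map (by fun_prop) (by fun_prop),
    (iIndepFun_iff_map_fun_eq_infinitePi_map (by fun_prop)).1 h,
    Measure.infinitePi_map_curry (fun i j => P.map (X i j))]
  congrm Measure.infinitePi fun i => ?_
  have h2 : iIndepFun (X i) P := h.precomp (g := fun j => (i, j)) (Prod.mk_right_injective i)
  rw [(iIndepFun_iff_map_fun_eq_infinitePi_map (by fun_prop)).1 h2]

/-- The exponential moments of the squared norm of a vector of independent copies of a linear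
combination of circularly symmetric Gaussians. -/
theorem exp_mul_sum_sq_norm_gaussian {Ω ι κ : Type*} [MeasurableSpace Ω] {P : Measure Ω}
    [IsProbabilityMeasure P] [Fintype ι] [Fintype κ] {g : κ → ι → Ω → ℂ} {v : ι → ℝ}
    (hv : ∀ j, 0 ≤ v j) (hg : ∀ m j, Measurable (g m j))
    (hlaw : ∀ m j, P.map (g m j) = complexGaussian (v j))
    (hind : iIndepFun (fun (p : κ × ι) ω => g p.1 p.2 ω) P) (c : ι → ℂ) {s : ℝ}
    (hs : s * ∑ j, ‖c j‖ ^ 2 * v j < 1) :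
    Integrable (fun ω => Real.exp (s * ∑ m, ‖∑ j, c j * g m j ω‖ ^ 2)) P ∧
      ∫ ω, Real.exp (s * ∑ m, ‖∑ j, c j * g m j ω‖ ^ 2) ∂P =
        (1 - s * ∑ j, ‖c j‖ ^ 2 * v j)⁻¹ ^ Fintype.card κ := by
  have hw : 0 ≤ ∑ j, ‖c j‖ ^ 2 * v j :=
    Finset.sum_nonneg fun j _ => mul_nonneg (by positivity) (hv j)
  set X : κ → Ω → ℝ := fun m ω => ‖∑ j, c j * g m j ω‖ ^ 2 with hX
  have hXm : ∀ m, Measurable (X m) := fun m => by fun_prop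
  have hXi : iIndepFun X P :=
    (iIndepFun_curry hg hind).comp (fun _ z => ‖∑ j, c j * z j‖ ^ 2) (fun _ => by fun_prop)
  have hl : ∀ m, P.map (fun ω => ∑ j, c j * g m j ω) = complexGaussian (∑ j, ‖c j‖ ^ 2 * v j) :=
    fun m => map_sum_mul_complexGaussian hv (hg m) (hlaw m)
      (hind.precomp (g := fun j => (m, j)) (Prod.mk_right_injective m)) c
  obtain ⟨k1, k2⟩ := exp_mul_sq_norm_complexGaussian hw hs
  have hXint : ∀ m, Integrable (fun ω => Real.exp (s * X m ω)) P ∧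
      mgf (X m) P s = (1 - s * ∑ j, ‖c j‖ ^ 2 * v j)⁻¹ := by
    intro m
    rw [← hl m] at k1 k2
    rw [integrable_map_measure (Continuous.aestronglyMeasurable (by fun_prop))
      (by fun_prop)] at k1
    rw [integral_map (by fun_prop) (Continuous.aestronglyMeasurable (by fun_prop))] at k2
    exact ⟨k1, k2⟩
  have e : ∀ ω, ∑ m, ‖∑ j, c j * g m j ω‖ ^ 2 = (∑ m, X m) ω := by
    intro ω
    simp [hX]
  simp_rw [e]
  refine ⟨hXi.integrable_exp_mul_sum hXm (fun m _ => (hXint m).1), ?_⟩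
  change mgf (∑ m, X m) P s = _
  rw [hXi.mgf_sum hXm, Finset.prod_congr rfl fun m _ => (hXint m).2, Finset.prod_const,
    Finset.card_univ]

/-! ### Chernoff bounds for Gamma-type variables. -/

theorem inv_one_add_le_exp {s : ℝ} (hs : 0 ≤ s) : (1 + s)⁻¹ ≤ Real.exp (-s + s ^ 2 / 2) := by
  have h1 := Real.le_log_one_add_of_nonneg hs
  have h2 : s - s ^ 2 / 2 ≤ 2 * s / (s + 2) := by
    rw [le_div_iff₀ (by linarith)]
    nlinarith [pow_nonneg hs 3]
  rw [← Real.log_le_iff_le_exp (by positivity), Real.log_inv]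
  linarith

theorem inv_one_sub_le_exp {s : ℝ} (hs : 0 ≤ s) (hs' : s ≤ 1 / 2) :
    (1 - s)⁻¹ ≤ Real.exp (s + s ^ 2) := by
  have h1 := Real.quadratic_le_exp_of_nonneg (x := s + s ^ 2) (by positivity)
  refine le_trans ?_ h1
  rw [inv_le_iff_one_le_mul₀ (by linarith)]
  -- With `y = s + s²`, this product equals `(1 - s) * (1 + y + y² / 2) - 1`.
  have : 0 ≤ s ^ 2 * ((1 - s) * (1 + s) ^ 2 / 2 - s) := by
    refine mul_nonneg (by positivity) ?_
    nlinarith [mul_nonneg hs (sub_nonneg.2 hs')]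
  nlinarith [this]

/-- Lower tail of a normalised sum of squares with Gamma-type exponential moments. -/
theorem measure_lower_tail_le {Ω : Type*} [MeasurableSpace Ω] {P : Measure Ω}
    [IsProbabilityMeasure P] {Q : Ω → ℝ} {v δ : ℝ} {n : ℕ} (hv : 0 < v) (hδ : 0 ≤ δ)
    (hQ : Integrable (fun ω => Real.exp (-(δ / v) * Q ω)) P)
    (hQ' : ∫ ω, Real.exp (-(δ / v) * Q ω) ∂P ≤ (1 + δ)⁻¹ ^ n) :
    P.real {ω | Q ω ≤ (1 - δ) * (n * v)} ≤ Real.exp (-(n * δ ^ 2 / 2)) := by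
  have h := measure_le_le_exp_mul_mgf ((1 - δ) * (n * v)) (t := -(δ / v))
    (by rw [neg_nonpos]; positivity) hQ
  refine h.trans ?_
  have h2 : mgf Q P (-(δ / v)) ≤ Real.exp (-δ + δ ^ 2 / 2) ^ n :=
    hQ'.trans (pow_le_pow_left₀ (by positivity) (inv_one_add_le_exp hδ) n)
  refine (mul_le_mul_of_nonneg_left h2 (Real.exp_pos _).le).trans (le_of_eq ?_)
  -- The exponents add up to `n * (δ - δ²) + n * (-δ + δ² / 2) = -n * δ² / 2`.
  rw [← Real.exp_nat_mul, ← Real.exp_add]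
  congr 1
  field_simp
  ring

/-- Upper tail of a weighted sum of possibly dependent variables with Gamma-type exponential
moments. -/
theorem measure_upper_tail_le {Ω ι : Type*} [MeasurableSpace Ω] {P : Measure Ω}
    [IsProbabilityMeasure P] [Fintype ι] {Q : ι → Ω → ℝ} {v : ι → ℝ} {δ : ℝ} {n : ℕ}
    (hQm : ∀ i, Measurable (Q i)) (hv : ∀ i, 0 < v i) (hV : 0 < ∑ i, v i) (hδ : 0 ≤ δ)
    (hδ' : δ ≤ 1)
    (hQ : ∀ i, Integrable (fun ω => Real.exp (δ / 2 / v i * Q i ω)) P)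
    (hQ' : ∀ i, ∫ ω, Real.exp (δ / 2 / v i * Q i ω) ∂P ≤ (1 - δ / 2)⁻¹ ^ n) :
    P.real {ω | (1 + δ) * (n * ∑ i, v i) ≤ ∑ i, Q i ω} ≤ Real.exp (-(n * δ ^ 2 / 4)) := by
  set V := ∑ i, v i with hVdef
  -- Jensen with weights `v i / V` reduces the sum to its individual terms, so no joint law is
  -- needed.
  have hconv : ∀ ω, Real.exp (δ / 2 / V * ∑ i, Q i ω) ≤
      ∑ i, v i / V * Real.exp (δ / 2 / v i * Q i ω) := by
    intro ω
    have h := convexOn_exp.map_sum_le (t := Finset.univ) (w := fun i => v i / V)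
      (p := fun i => δ / 2 / v i * Q i ω) (fun i _ => (div_pos (hv i) hV).le)
      (by rw [← Finset.sum_div, div_self hV.ne']) (fun i _ => Set.mem_univ _)
    simp only [smul_eq_mul] at h
    refine (le_of_eq ?_).trans h
    rw [Finset.mul_sum]
    congr 1
    refine Finset.sum_congr rfl fun i _ => ?_
    have := (hv i).ne'
    field_simp
  have hI : Integrable (fun ω => ∑ i, v i / V * Real.exp (δ / 2 / v i * Q i ω)) P :=
    integrable_finsetSum _ fun i _ => (hQ i).const_mul _
  have hI' : Integrable (fun ω => Real.exp (δ / 2 / V * ∑ i, Q i ω)) P := by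
    refine hI.mono' (Measurable.aestronglyMeasurable (by fun_prop))
      (Filter.Eventually.of_forall fun ω => ?_)
    rw [Real.norm_eq_abs, abs_of_pos (Real.exp_pos _)]
    exact hconv ω
  have h := measure_ge_le_exp_mul_mgf (X := fun ω => ∑ i, Q i ω) ((1 + δ) * (n * V))
    (t := δ / 2 / V) (by positivity) hI'
  refine h.trans ?_
  have h2 : mgf (fun ω => ∑ i, Q i ω) P (δ / 2 / V) ≤
      Real.exp (δ / 2 + (δ / 2) ^ 2) ^ n := by
    calc mgf (fun ω => ∑ i, Q i ω) P (δ / 2 / V)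
        ≤ ∫ ω, ∑ i, v i / V * Real.exp (δ / 2 / v i * Q i ω) ∂P :=
          integral_mono hI' hI hconv
      _ = ∑ i, v i / V * ∫ ω, Real.exp (δ / 2 / v i * Q i ω) ∂P := by
          rw [integral_finsetSum _ fun i _ => (hQ i).const_mul _]
          simp_rw [integral_const_mul]
      _ ≤ ∑ i, v i / V * (1 - δ / 2)⁻¹ ^ n :=
          Finset.sum_le_sum fun i _ => mul_le_mul_of_nonneg_left (hQ' i) (div_pos (hv i) hV).le
      _ = (1 - δ / 2)⁻¹ ^ n := by
          rw [← Finset.sum_mul, ← Finset.sum_div, div_self hV.ne', one_mul]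
      _ ≤ _ := pow_le_pow_left₀ (inv_nonneg.2 (by linarith))
          (inv_one_sub_le_exp (by positivity) (by linarith)) n
  refine (mul_le_mul_of_nonneg_left h2 (Real.exp_pos _).le).trans (le_of_eq ?_)
  rw [← Real.exp_nat_mul, ← Real.exp_add]
  congr 1
  field_simp
  ring

/-! ### The statistics as squared norms of Gaussian vectors. -/

theorem stat_eq_sum_sq_norm {D N M : ℕ} (a : Fin N → EuclideanSpace ℂ (Fin D))
    (Y : Matrix (Fin D) (Fin M) ℂ) (k : Fin N) :
    stat a Y k = (M : ℝ)⁻¹ * ∑ m, ‖∑ i, starRingEnd ℂ (a k i) * Y i m‖ ^ 2 := by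
  have h : statC a Y k = (((M : ℝ)⁻¹ * ∑ m, ‖∑ i, starRingEnd ℂ (a k i) * Y i m‖ ^ 2 : ℝ) : ℂ) := by
    push_cast
    simp_rw [← Complex.mul_conj', map_sum, map_mul, Complex.conj_conj, Finset.sum_mul_sum]
    unfold statC sampleCov
    simp only [Matrix.smul_apply, Matrix.mul_apply, Matrix.conjTranspose_apply, smul_eq_mul,
      RCLike.star_def, Finset.mul_sum]
    rw [eq_comm, Finset.sum_comm]
    refine Finset.sum_congr rfl fun i _ => ?_
    rw [Finset.sum_comm]
    refine Finset.sum_congr rfl fun j _ => Finset.sum_congr rfl fun m _ => ?_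
    ring
  rw [stat, h, Complex.ofReal_re]

theorem sum_conj_mul_receivedSignal {D N M : ℕ} (a : Fin N → EuclideanSpace ℂ (Fin D))
    (γ : Fin N → ℝ) (H : Matrix (Fin N) (Fin M) ℂ) (Z : Matrix (Fin D) (Fin M) ℂ)
    (k : Fin N) (m : Fin M) :
    ∑ i, starRingEnd ℂ (a k i) * receivedSignal a γ H Z i m =
      ∑ l, ((Real.sqrt (γ l) : ℝ) * inner ℂ (a k) (a l)) * H l m +
        ∑ i, starRingEnd ℂ (a k i) * Z i m := by
  simp only [receivedSignal, Matrix.add_apply, mul_add, Finset.sum_add_distrib]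
  congr 1
  have h : ∀ i, (codebook a * Matrix.diagonal (fun k => ((Real.sqrt (γ k) : ℝ) : ℂ)) * H) i m =
      ∑ l, a l i * (Real.sqrt (γ l) : ℝ) * H l m := by
    intro i
    rw [Matrix.mul_apply]
    simp [Matrix.mul_diagonal, codebook]
  simp only [h, PiLp.inner_apply, RCLike.inner_apply, Finset.mul_sum, Finset.sum_mul]
  rw [Finset.sum_comm]
  refine Finset.sum_congr rfl fun l _ => Finset.sum_congr rfl fun i _ => ?_
  ring

/-- The conditional mean of the statistic `𝒴_k` given the codebook. -/
noncomputable def statMean {D N : ℕ} (σ : ℝ) (γ : Fin N → ℝ) (a : Fin N → EuclideanSpace ℂ (Fin D))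
    (k : Fin N) : ℝ :=
  ∑ l, γ l * ‖inner ℂ (a k) (a l)‖ ^ 2 + σ ^ 2 * ‖a k‖ ^ 2

/-! ### Detection for a fixed codebook. -/

section FixedCodebook

variable {Ω : Type*} [MeasurableSpace Ω] {P : Measure Ω} [IsProbabilityMeasure P] {D N M : ℕ}
  {σ : ℝ} {H : Fin N → Fin M → Ω → ℂ} {Z : Fin D → Fin M → Ω → ℂ}

/-- Each column correlates with `a k` in a combination of independent Gaussians, with coefficients
`√(γ l) * ⟨a k, a l⟩` on the channel and `conj (a k i)` on the noise. The weighted squares of these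
coefficients sum to `statMean`, and the `M` columns are independent. -/
theorem exp_mul_stat_receivedSignal (hM : 0 < M) (hHm : ∀ k m, Measurable (H k m))
    (hZm : ∀ i m, Measurable (Z i m)) (hH : ∀ k m, P.map (H k m) = complexGaussian 1)
    (hZ : ∀ i m, P.map (Z i m) = complexGaussian (σ ^ 2))
    (hind : iIndepFun
      (Sum.elim (fun q : Fin N × Fin M => H q.1 q.2) (fun q : Fin D × Fin M => Z q.1 q.2)) P)
    {γ : Fin N → ℝ} (hγ : ∀ k, 0 ≤ γ k) (a : Fin N → EuclideanSpace ℂ (Fin D)) (k : Fin N)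
    {s : ℝ} (hs : s * statMean σ γ a k < 1) :
    Integrable (fun ω => Real.exp (s * (M * stat a (receivedSignal a γ
        (Matrix.of fun k m => H k m ω) (Matrix.of fun i m => Z i m ω)) k))) P ∧
      ∫ ω, Real.exp (s * (M * stat a (receivedSignal a γ
        (Matrix.of fun k m => H k m ω) (Matrix.of fun i m => Z i m ω)) k)) ∂P =
        (1 - s * statMean σ γ a k)⁻¹ ^ M := by
  set g : Fin M → Fin N ⊕ Fin D → Ω → ℂ :=
    fun m => Sum.elim (fun l => H l m) (fun i => Z i m) with hg
  set v : Fin N ⊕ Fin D → ℝ := Sum.elim (fun _ => 1) (fun _ => σ ^ 2) with hv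
  set c : Fin N ⊕ Fin D → ℂ := Sum.elim (fun l => (Real.sqrt (γ l) : ℝ) * inner ℂ (a k) (a l))
    (fun i => starRingEnd ℂ (a k i)) with hc
  have hM0 : (M : ℝ) ≠ 0 := by positivity
  have e1 : ∑ j, ‖c j‖ ^ 2 * v j = statMean σ γ a k := by
    rw [Fintype.sum_sum_type, statMean, EuclideanSpace.norm_sq_eq]
    simp only [hc, hv, Sum.elim_inl, Sum.elim_inr, mul_one, RCLike.norm_conj, norm_mul, mul_pow,
      Complex.norm_real, Real.norm_eq_abs, sq_abs, Finset.mul_sum]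
    congr 1
    · exact Finset.sum_congr rfl fun l _ => by rw [Real.sq_sqrt (hγ l)]
    · exact Finset.sum_congr rfl fun l _ => mul_comm _ _
  have e2 : ∀ ω, (M : ℝ) * stat a (receivedSignal a γ
        (Matrix.of fun k m => H k m ω) (Matrix.of fun i m => Z i m ω)) k =
      ∑ m, ‖∑ j, c j * g m j ω‖ ^ 2 := by
    intro ω
    rw [stat_eq_sum_sq_norm, mul_inv_cancel_left₀ hM0]
    refine Finset.sum_congr rfl fun m _ => ?_
    rw [sum_conj_mul_receivedSignal, Fintype.sum_sum_type]
    rfl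
  have hgi : iIndepFun (fun (p : Fin M × (Fin N ⊕ Fin D)) ω => g p.1 p.2 ω) P := by
    have h := hind.precomp (g := fun p : Fin M × (Fin N ⊕ Fin D) =>
      Sum.elim (fun l => (Sum.inl (l, p.1) : (Fin N × Fin M) ⊕ (Fin D × Fin M)))
        (fun i => Sum.inr (i, p.1)) p.2) (by
      rintro ⟨m, l | i⟩ ⟨m', l' | i'⟩ h <;> simp_all)
    convert h using 2 with p
    rcases p with ⟨m, l | i⟩ <;> rfl
  have h := exp_mul_sum_sq_norm_gaussian (P := P) (g := g) (v := v)
    (by rintro (l | i)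
        · exact zero_le_one
        · exact sq_nonneg σ)
    (by rintro m (l | i)
        · exact hHm l m
        · exact hZm i m)
    (by rintro m (l | i)
        · exact hH l m
        · exact hZ i m) hgi c (s := s) (by rw [e1]; exact hs)
  simp_rw [e2]
  rw [e1, Fintype.card_fin] at h
  exact h

theorem measurable_stat_receivedSignal (γ : Fin N → ℝ) (k : Fin N) :
    Measurable fun p : (Fin N → EuclideanSpace ℂ (Fin D)) ×
        ((Fin N → Fin M → ℂ) × (Fin D → Fin M → ℂ)) =>
      stat p.1 (receivedSignal p.1 γ (Matrix.of p.2.1) (Matrix.of p.2.2)) k := by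
  simp_rw [stat_eq_sum_sq_norm, sum_conj_mul_receivedSignal]
  simp only [Matrix.of_apply]
  refine Continuous.measurable ?_
  fun_prop

/-- For a fixed codebook, detection succeeds up to an exponentially small probability as soon as
the conditional means of the statistics are separated. -/
theorem measure_not_support_subset_le (hM : 0 < M) (hN : 0 < N) (hHm : ∀ k m, Measurable (H k m))
    (hZm : ∀ i m, Measurable (Z i m)) (hH : ∀ k m, P.map (H k m) = complexGaussian 1)
    (hZ : ∀ i m, P.map (Z i m) = complexGaussian (σ ^ 2))
    (hind : iIndepFun
      (Sum.elim (fun q : Fin N × Fin M => H q.1 q.2) (fun q : Fin D × Fin M => Z q.1 q.2)) P)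
    {γ : Fin N → ℝ} (hγ : ∀ k, 0 ≤ γ k) (a : Fin N → EuclideanSpace ℂ (Fin D))
    {δ B L : ℝ} (hδ : 0 ≤ δ) (hδ' : δ ≤ 1) (hL : 0 < L)
    (hlow : ∀ k ∈ Function.support γ, L ≤ statMean σ γ a k)
    (hup : ∑ k, statMean σ γ a k < N * B) (hsep : (1 + δ) * B ≤ (1 - δ) * L) :
    P.real {ω | ¬ Function.support γ ⊆ firstStageSet 1 a (receivedSignal a γ
        (Matrix.of fun k m => H k m ω) (Matrix.of fun i m => Z i m ω))} ≤
      ((Function.support γ).ncard + 1) * Real.exp (-(M * δ ^ 2 / 4)) := by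
  classical
  set Q : Fin N → Ω → ℝ := fun k ω => M * stat a (receivedSignal a γ
        (Matrix.of fun k m => H k m ω) (Matrix.of fun i m => Z i m ω)) k with hQ
  have hQm : ∀ k, Measurable (Q k) := by
    intro k
    have h1 : Measurable fun ω => ((a, ((fun k m => H k m ω), (fun i m => Z i m ω))) :
        (Fin N → EuclideanSpace ℂ (Fin D)) × ((Fin N → Fin M → ℂ) × (Fin D → Fin M → ℂ))) := by
      fun_prop
    exact ((measurable_stat_receivedSignal γ k).comp h1).const_mul _
  have hv0 : ∀ k, 0 ≤ statMean σ γ a k := fun k =>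
    add_nonneg (Finset.sum_nonneg fun l _ => mul_nonneg (hγ l) (by positivity)) (by positivity)
  have hN0 : (0 : ℝ) < N := by positivity
  have hM0 : (0 : ℝ) < M := by positivity
  -- Spreading the slack equally makes every weight `w k` strictly positive, even where the variance
  -- vanishes, and their total exactly `N * B`. The moment bound only needs `w k` to dominate the
  -- variance.
  set τ : ℝ := B - (∑ k, statMean σ γ a k) / N with hτ
  have hτ0 : 0 < τ := by
    rw [hτ, sub_pos, div_lt_iff₀ hN0, mul_comm]
    exact hup
  set w : Fin N → ℝ := fun k => statMean σ γ a k + τ with hw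
  have hw0 : ∀ k, 0 < w k := fun k => add_pos_of_nonneg_of_pos (hv0 k) hτ0
  have hwsum : ∑ k, w k = N * B := by
    simp only [hw, Finset.sum_add_distrib, Finset.sum_const, Finset.card_univ, Fintype.card_fin,
      nsmul_eq_mul, hτ]
    field_simp
    ring
  have key := fun k s hs => exp_mul_stat_receivedSignal (s := s) hM hHm hZm hH hZ hind hγ a k hs
  have hlower : ∀ k ∈ Function.support γ,
      P.real {ω | Q k ω ≤ (1 - δ) * (M * statMean σ γ a k)} ≤ Real.exp (-(M * δ ^ 2 / 4)) := by
    intro k hk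
    have hvk : 0 < statMean σ γ a k := hL.trans_le (hlow k hk)
    have e : -(δ / statMean σ γ a k) * statMean σ γ a k = -δ := by field_simp
    obtain ⟨h1, h2⟩ := key k (-(δ / statMean σ γ a k)) (by rw [e]; linarith)
    rw [e, sub_neg_eq_add] at h2
    refine (measure_lower_tail_le hvk hδ h1 h2.le).trans ?_
    refine Real.exp_le_exp.2 ?_
    have : 0 ≤ M * δ ^ 2 := by positivity
    linarith
  have hupper : P.real {ω | (1 + δ) * (M * ∑ k, w k) ≤ ∑ k, Q k ω} ≤
      Real.exp (-(M * δ ^ 2 / 4)) := by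
    have e : ∀ k, δ / 2 / w k * statMean σ γ a k ≤ δ / 2 := by
      intro k
      rw [div_mul_eq_mul_div, div_le_iff₀ (hw0 k)]
      refine mul_le_mul_of_nonneg_left ?_ (by positivity)
      simp only [hw]
      linarith
    have e' : ∀ k, δ / 2 / w k * statMean σ γ a k < 1 := fun k => (e k).trans_lt (by linarith)
    refine measure_upper_tail_le hQm hw0 ?_ hδ hδ' (fun k => (key k _ (e' k)).1) (fun k => ?_)
    · have : Nonempty (Fin N) := ⟨⟨0, hN⟩⟩
      exact Finset.sum_pos (fun k _ => hw0 k) Finset.univ_nonempty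
    · rw [(key k _ (e' k)).2]
      refine pow_le_pow_left₀ (inv_nonneg.2 (by linarith [e' k])) ?_ M
      exact inv_anti₀ (by linarith) (by linarith [e k])
  have hfin : (Function.support γ).Finite := Set.toFinite _
  have hsub : {ω | ¬ Function.support γ ⊆ firstStageSet 1 a (receivedSignal a γ
        (Matrix.of fun k m => H k m ω) (Matrix.of fun i m => Z i m ω))} ⊆
      (⋃ k ∈ hfin.toFinset, {ω | Q k ω ≤ (1 - δ) * (M * statMean σ γ a k)}) ∪
        {ω | (1 + δ) * (M * ∑ k, w k) ≤ ∑ k, Q k ω} := by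
    intro ω hω
    by_contra hcon
    simp only [Set.mem_union, Set.mem_iUnion, Set.mem_ofPred_eq, not_or, not_exists, not_le,
      Set.Finite.mem_toFinset] at hcon
    obtain ⟨h1, h2⟩ := hcon
    refine hω fun k hk => ?_
    have h3 := h1 k hk
    have h4 : (1 + δ) * B ≤ (1 - δ) * statMean σ γ a k :=
      hsep.trans (mul_le_mul_of_nonneg_left (hlow k hk) (by linarith))
    rw [hwsum] at h2
    simp only [hQ, ← Finset.mul_sum] at h2 h3
    simp only [firstStageSet, Set.mem_ofPred_eq, one_mul]
    have h5 : ∑ k, stat a (receivedSignal a γ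
        (Matrix.of fun k m => H k m ω) (Matrix.of fun i m => Z i m ω)) k < N * ((1 + δ) * B) := by
      refine lt_of_mul_lt_mul_left (lt_of_lt_of_eq h2 ?_) hM0.le
      ring
    have h6 : (1 - δ) * statMean σ γ a k < stat a (receivedSignal a γ
        (Matrix.of fun k m => H k m ω) (Matrix.of fun i m => Z i m ω)) k := by
      refine lt_of_mul_lt_mul_left (lt_of_eq_of_lt ?_ h3) hM0.le
      ring
    refine lt_trans ?_ (h4.trans_lt h6)
    rw [one_div, inv_mul_lt_iff₀ hN0]
    exact h5
  refine (measureReal_mono hsub).trans ((measureReal_union_le _ _).trans ?_)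
  rw [add_mul ((Function.support γ).ncard : ℝ) 1, one_mul]
  refine add_le_add ((measureReal_biUnion_finset_le _ _).trans ?_) hupper
  refine (Finset.sum_le_sum fun k hk => hlower k (by simpa using hk)).trans (le_of_eq ?_)
  rw [Finset.sum_const, nsmul_eq_mul, Set.ncard_eq_toFinset_card _ hfin]

end FixedCodebook

/-! ### Tails of inner products on the complex sphere. -/

section UniformSphere

variable {D : ℕ}

theorem finrank_real_euclideanSpace_complex :
    Module.finrank ℝ (EuclideanSpace ℂ (Fin D)) = 2 * D := by
  rw [(WithLp.linearEquiv 2 ℝ (Fin D → ℂ)).finrank_eq, Module.finrank_pi_fintype]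
  simp [Complex.finrank_real_complex, mul_comm]

theorem toSphere_univ_ne_zero (hD : 0 < D) :
    (volume : Measure (EuclideanSpace ℂ (Fin D))).toSphere Set.univ ≠ 0 := by
  have : NeZero D := ⟨hD.ne'⟩
  rw [Measure.measure_univ_ne_zero]
  exact Measure.toSphere_ne_zero _

theorem lintegral_uniformSphere {f : EuclideanSpace ℂ (Fin D) → ENNReal} (hf : Measurable f) :
    ∫⁻ x, f x ∂(uniformSphere D) =
      ((volume : Measure (EuclideanSpace ℂ (Fin D))).toSphere Set.univ)⁻¹ *
        ∫⁻ θ, f (Real.sqrt D • θ.1)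
          ∂(volume : Measure (EuclideanSpace ℂ (Fin D))).toSphere := by
  rw [uniformSphere, lintegral_map hf (by fun_prop), lintegral_smul_measure, smul_eq_mul]

theorem isProbabilityMeasure_uniformSphere (hD : 0 < D) :
    IsProbabilityMeasure (uniformSphere D) := by
  constructor
  have h := lintegral_uniformSphere (D := D) (f := fun _ => 1) measurable_const
  rw [lintegral_one, lintegral_one] at h
  rw [h]
  exact ENNReal.inv_mul_cancel (toSphere_univ_ne_zero hD) (measure_ne_top _ _)

theorem ae_norm_sq_uniformSphere : ∀ᵐ x ∂(uniformSphere D), ‖x‖ ^ 2 = D := by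
  have hm : MeasurableSet {x : EuclideanSpace ℂ (Fin D) | ‖x‖ ^ 2 = D} :=
    measurableSet_eq_fun (by fun_prop) (by fun_prop)
  rw [uniformSphere, ae_map_iff (by fun_prop) hm]
  refine Filter.Eventually.of_forall fun θ => ?_
  have hθ : ‖θ.1‖ = 1 := by simp
  rw [norm_smul, hθ, mul_one, Real.norm_eq_abs, sq_abs, Real.sq_sqrt (by positivity)]

theorem uniformSphere_sq_inner_real_le (hD : 0 < D) {u : EuclideanSpace ℂ (Fin D)} (hu : ‖u‖ = 1)
    (s : ℝ) :
    uniformSphere D {x | s ≤ inner ℝ u x ^ 2} ≤ ENNReal.ofReal (2 * Real.exp (-(s / 2))) := by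
  have : NeZero D := ⟨hD.ne'⟩
  have hmeas : Measurable fun x : EuclideanSpace ℂ (Fin D) =>
      ENNReal.ofReal (Real.exp (inner ℝ u x ^ 2 / 2)) := by fun_prop
  -- The real dimension is `2 * D`, so `l = 1 / 2` gives the exponent `D * ⟨u, θ⟩² / 2`, which is
  -- `⟨u, x⟩² / 2` at `x = √D • θ`.
  have h1 := lintegral_toSphere_exp_sq_inner_le hu (l := 1 / 2) (by norm_num)
  have h2 : ∫⁻ x, ENNReal.ofReal (Real.exp (inner ℝ u x ^ 2 / 2)) ∂(uniformSphere D) ≤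
      ENNReal.ofReal 2 := by
    rw [lintegral_uniformSphere hmeas, ENNReal.inv_mul_le_iff (toSphere_univ_ne_zero hD)
      (measure_ne_top _ _)]
    refine (le_of_eq ?_).trans (h1.trans ?_)
    · refine lintegral_congr fun θ => ?_
      rw [inner_smul_right, mul_pow, Real.sq_sqrt (by positivity),
        finrank_real_euclideanSpace_complex]
      congr 2
      push_cast
      ring
    · rw [mul_comm]
      refine mul_le_mul_right (ENNReal.ofReal_le_ofReal ?_) _
      have : (1 - 1 / 2 : ℝ)⁻¹ = 2 := by norm_num
      rw [this]
      calc (2 : ℝ) ^ (1 / 2 : ℝ) ≤ 2 ^ (1 : ℝ) :=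
            Real.rpow_le_rpow_of_exponent_le (by norm_num) (by norm_num)
        _ = 2 := Real.rpow_one 2
  have h3 : {x : EuclideanSpace ℂ (Fin D) | s ≤ inner ℝ u x ^ 2} ⊆
      {x | ENNReal.ofReal (Real.exp (s / 2)) ≤
        ENNReal.ofReal (Real.exp (inner ℝ u x ^ 2 / 2))} := by
    intro x hx
    have hx : s ≤ inner ℝ u x ^ 2 := hx
    exact ENNReal.ofReal_le_ofReal (Real.exp_le_exp.2 (by linarith))
  refine (measure_mono h3).trans ((meas_ge_le_lintegral_div hmeas.aemeasurable
    (by simpa using Real.exp_pos _) ENNReal.ofReal_ne_top).trans ?_)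
  rw [Real.exp_neg, ← div_eq_mul_inv, ENNReal.ofReal_div_of_pos (Real.exp_pos _)]
  exact ENNReal.div_le_div_right h2 _

theorem inner_real_eq_re (x y : EuclideanSpace ℂ (Fin D)) :
    inner ℝ x y = (inner ℂ x y).re := by
  simp only [PiLp.inner_apply, Complex.re_sum]
  rfl

/-- For `u = b / √D`, real and imaginary part of `⟨u, x⟩` are, up to sign, the real inner products
of `x` with `u` and `I • u`. If their squares sum to at least `t`, one of them is at least `t / 2`.
-/
theorem uniformSphere_sq_norm_inner_le (hD : 0 < D) {b : EuclideanSpace ℂ (Fin D)}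
    (hb : ‖b‖ ^ 2 = D) (t : ℝ) :
    uniformSphere D {x | t * D ≤ ‖inner ℂ b x‖ ^ 2} ≤
      ENNReal.ofReal (4 * Real.exp (-(t / 4))) := by
  have hD0 : (0 : ℝ) < D := by positivity
  have hb1 : ‖b‖ = Real.sqrt D := by rw [← hb, Real.sqrt_sq (norm_nonneg b)]
  have hs0 : 0 < Real.sqrt D := Real.sqrt_pos.2 hD0
  set u : EuclideanSpace ℂ (Fin D) := ((Real.sqrt D)⁻¹ : ℂ) • b with hu
  have hu1 : ‖u‖ = 1 := by
    rw [hu, norm_smul, hb1, norm_inv, Complex.norm_real, Real.norm_eq_abs, abs_of_pos hs0,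
      inv_mul_cancel₀ hs0.ne']
  have hu2 : ‖Complex.I • u‖ = 1 := by rw [norm_smul, hu1, Complex.norm_I, mul_one]
  have hsub : {x : EuclideanSpace ℂ (Fin D) | t * D ≤ ‖inner ℂ b x‖ ^ 2} ⊆
      {x | t / 2 ≤ inner ℝ u x ^ 2} ∪ {x | t / 2 ≤ inner ℝ (Complex.I • u) x ^ 2} := by
    intro x hx
    have hx : t * D ≤ ‖inner ℂ b x‖ ^ 2 := hx
    have e : ‖inner ℂ b x‖ ^ 2 =
        D * (inner ℝ u x ^ 2 + inner ℝ (Complex.I • u) x ^ 2) := by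
      rw [inner_real_eq_re, inner_real_eq_re, inner_smul_left u x Complex.I]
      have e1 : (starRingEnd ℂ Complex.I * inner ℂ u x).re = (inner ℂ u x).im := by simp
      rw [e1]
      have e2 : (inner ℂ u x).re ^ 2 + (inner ℂ u x).im ^ 2 = ‖inner ℂ u x‖ ^ 2 := by
        rw [← Complex.normSq_eq_norm_sq, Complex.normSq_apply]
        ring
      rw [e2, hu, inner_smul_left, norm_mul, RCLike.norm_conj, norm_inv, Complex.norm_real,
        Real.norm_eq_abs, abs_of_pos hs0, mul_pow, inv_pow, Real.sq_sqrt hD0.le,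
        mul_inv_cancel_left₀ hD0.ne']
    rw [e, mul_comm] at hx
    have hx' := le_of_mul_le_mul_left hx hD0
    by_contra hcon
    simp only [Set.mem_union, Set.mem_ofPred_eq, not_or, not_le] at hcon
    linarith [hcon.1, hcon.2]
  refine (measure_mono hsub).trans ((measure_union_le _ _).trans
    ((add_le_add (uniformSphere_sq_inner_real_le hD hu1 _)
      (uniformSphere_sq_inner_real_le hD hu2 _)).trans (le_of_eq ?_)))
  rw [← ENNReal.ofReal_add (by positivity) (by positivity)]
  congr 1
  ring_nf

theorem measure_sq_norm_inner_le {Ω : Type*} [MeasurableSpace Ω] {P : Measure Ω}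
    [IsProbabilityMeasure P] (hD : 0 < D) {X Y : Ω → EuclideanSpace ℂ (Fin D)}
    (hXm : Measurable X) (hYm : Measurable Y) (hX : P.map X = uniformSphere D)
    (hY : P.map Y = uniformSphere D) (hXY : IndepFun X Y P) (t : ℝ) :
    P.real {ω | t * D ≤ ‖inner ℂ (X ω) (Y ω)‖ ^ 2} ≤ 4 * Real.exp (-(t / 4)) := by
  have := isProbabilityMeasure_uniformSphere hD
  have hS : MeasurableSet {p : EuclideanSpace ℂ (Fin D) × EuclideanSpace ℂ (Fin D) |
      t * D ≤ ‖inner ℂ p.1 p.2‖ ^ 2} := measurableSet_le (by fun_prop) (by fun_prop)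
  refine ENNReal.toReal_le_of_le_ofReal (by positivity) ?_
  have h1 : P {ω | t * D ≤ ‖inner ℂ (X ω) (Y ω)‖ ^ 2} =
      (P.map fun ω => (X ω, Y ω)) {p | t * D ≤ ‖inner ℂ p.1 p.2‖ ^ 2} := by
    rw [Measure.map_apply (by fun_prop) hS]
    rfl
  rw [h1, (indepFun_iff_map_prod_eq_prod_map_map hXm.aemeasurable hYm.aemeasurable).1 hXY, hX, hY,
    Measure.prod_apply hS]
  calc _ ≤ ∫⁻ _, ENNReal.ofReal (4 * Real.exp (-(t / 4))) ∂(uniformSphere D) := by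
        refine lintegral_mono_ae ?_
        filter_upwards [ae_norm_sq_uniformSphere (D := D)] with b hb
        exact uniformSphere_sq_norm_inner_le hD hb t
    _ = _ := by simp

end UniformSphere

/-- By Fubini, a bound valid for every frozen value `x ∈ G` survives averaging over `X`. -/
theorem measure_and_le_of_indepFun {Ω α β : Type*} [MeasurableSpace Ω] [MeasurableSpace α]
    [MeasurableSpace β] {P : Measure Ω} [IsProbabilityMeasure P] {X : Ω → α} {Y : Ω → β}
    (hX : Measurable X) (hY : Measurable Y) (hXY : IndepFun X Y P) {G : Set α}
    (hG : MeasurableSet G) {S : Set (α × β)} (hS : MeasurableSet S) {ε : ℝ} (hε : 0 ≤ ε)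
    (h : ∀ x ∈ G, P.real {ω | (x, Y ω) ∈ S} ≤ ε) :
    P.real {ω | X ω ∈ G ∧ (X ω, Y ω) ∈ S} ≤ ε := by
  refine ENNReal.toReal_le_of_le_ofReal hε ?_
  have hT : MeasurableSet (Prod.fst ⁻¹' G ∩ S) := (measurable_fst hG).inter hS
  have := Measure.isProbabilityMeasure_map (μ := P) hX.aemeasurable
  have h1 : P {ω | X ω ∈ G ∧ (X ω, Y ω) ∈ S} =
      (P.map fun ω => (X ω, Y ω)) (Prod.fst ⁻¹' G ∩ S) := by
    rw [Measure.map_apply (by fun_prop) hT]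
    rfl
  rw [h1, (indepFun_iff_map_prod_eq_prod_map_map hX.aemeasurable hY.aemeasurable).1 hXY,
    Measure.prod_apply hT]
  calc _ ≤ ∫⁻ _, ENNReal.ofReal ε ∂(P.map X) := by
        refine lintegral_mono fun x => ?_
        by_cases hx : x ∈ G
        · rw [Measure.map_apply hY (measurable_prodMk_left hT)]
          refine (measure_mono (t := {ω | (x, Y ω) ∈ S}) fun ω hω => hω.2).trans ?_
          rw [← ENNReal.ofReal_toReal (measure_ne_top P _)]
          exact ENNReal.ofReal_le_ofReal (h x hx)
        · have : Prod.mk x ⁻¹' (Prod.fst ⁻¹' G ∩ S) = ∅ := by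
            ext y
            simp [hx]
          rw [this, measure_empty]
          exact zero_le
    _ = _ := by simp

/-- Codebooks on the sphere of radius `√D` whose words indexed by `S` have squared inner products
at most `μ` with all other words. -/
def incoherentCodebooks (D N : ℕ) (S : Set (Fin N)) (μ : ℝ) :
    Set (Fin N → EuclideanSpace ℂ (Fin D)) :=
  {a | (∀ k, ‖a k‖ ^ 2 = D) ∧ ∀ k, ∀ l ∈ S, k ≠ l → ‖inner ℂ (a k) (a l)‖ ^ 2 ≤ μ}

theorem measurableSet_incoherentCodebooks (D N : ℕ) (S : Set (Fin N)) (μ : ℝ) :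
    MeasurableSet (incoherentCodebooks D N S μ) := by
  have : incoherentCodebooks D N S μ = (⋂ k, {a | ‖a k‖ ^ 2 = D}) ∩
      ⋂ k, ⋂ l, ⋂ (_ : l ∈ S), ⋂ (_ : k ≠ l), {a | ‖inner ℂ (a k) (a l)‖ ^ 2 ≤ μ} := by
    ext a
    simp [incoherentCodebooks]
  rw [this]
  refine (MeasurableSet.iInter fun k => measurableSet_eq_fun (by fun_prop) (by fun_prop)).inter ?_
  exact MeasurableSet.iInter fun k => MeasurableSet.iInter fun l => MeasurableSet.iInter fun _ =>
    MeasurableSet.iInter fun _ => measurableSet_le (by fun_prop) (by fun_prop)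

theorem measure_not_incoherentCodebooks_le {Ω : Type*} [MeasurableSpace Ω] {P : Measure Ω}
    [IsProbabilityMeasure P] {D N : ℕ} (hD : 0 < D) {a : Fin N → Ω → EuclideanSpace ℂ (Fin D)}
    (ham : ∀ k, Measurable (a k)) (ha : ∀ k, P.map (a k) = uniformSphere D)
    (hind : iIndepFun a P) (S : Set (Fin N)) (t : ℝ) :
    P.real {ω | (fun k => a k ω) ∉ incoherentCodebooks D N S (t * D)} ≤
      4 * (N : ℝ) ^ 2 * Real.exp (-(t / 4)) := by
  have hnorm : ∀ᵐ ω ∂P, ∀ k, ‖a k ω‖ ^ 2 = D := by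
    rw [ae_all_iff]
    intro k
    have h := ae_norm_sq_uniformSphere (D := D)
    rw [← ha k] at h
    exact ae_of_ae_map (ham k).aemeasurable h
  -- The union bound runs over all ordered pairs of distinct indices, ignoring `S`; there are at
  -- most `N ^ 2`.
  set U : Finset (Fin N × Fin N) := Finset.univ.filter fun p => p.1 ≠ p.2 with hU
  have h1 : P.real {ω | (fun k => a k ω) ∉ incoherentCodebooks D N S (t * D)} ≤
      P.real (⋃ p ∈ U, {ω | t * D ≤ ‖inner ℂ (a p.1 ω) (a p.2 ω)‖ ^ 2}) := by
    refine ENNReal.toReal_mono (measure_ne_top _ _) (measure_mono_ae ?_)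
    filter_upwards [hnorm] with ω hω hbad
    by_contra hcon
    refine hbad ⟨hω, fun k l _ hkl => ?_⟩
    by_contra hlt
    refine hcon (Set.mem_biUnion (x := (k, l)) (by simpa [hU] using hkl) ?_)
    exact (not_le.1 hlt).le
  refine h1.trans ((measureReal_biUnion_finset_le _ _).trans ?_)
  refine (Finset.sum_le_sum fun p hp => measure_sq_norm_inner_le hD (ham p.1) (ham p.2)
    (ha p.1) (ha p.2) (hind.indepFun (by simpa [hU] using hp)) t).trans ?_
  rw [Finset.sum_const, nsmul_eq_mul]
  have hc : (U.card : ℝ) ≤ (N : ℝ) ^ 2 := by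
    have := Finset.card_le_univ U
    rw [Fintype.card_prod, Fintype.card_fin] at this
    rw [sq]
    exact_mod_cast this
  calc (U.card : ℝ) * (4 * Real.exp (-(t / 4))) ≤ (N : ℝ) ^ 2 * (4 * Real.exp (-(t / 4))) :=
        mul_le_mul_of_nonneg_right hc (by positivity)
    _ = _ := by ring

/-! ### Separation of the conditional means for incoherent codebooks. -/

section Gamma

variable {N : ℕ} {γ : Fin N → ℝ}

theorem gammaMin_le {k : Fin N} (hk : k ∈ Function.support γ) : gammaMin γ ≤ γ k :=
  csInf_le (Set.toFinite _).bddBelow ⟨k, hk, rfl⟩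

theorem le_gammaMax {k : Fin N} (hk : k ∈ Function.support γ) : γ k ≤ gammaMax γ :=
  le_csSup (Set.toFinite _).bddAbove ⟨k, hk, rfl⟩

theorem gammaMin_pos (hγ : ∀ k, 0 ≤ γ k) (hne : (Function.support γ).Nonempty) :
    0 < gammaMin γ := by
  obtain ⟨k, hk, e⟩ := (hne.image γ).csInf_mem (Set.toFinite _)
  rw [gammaMin, ← e]
  exact lt_of_le_of_ne (hγ k) (Ne.symm hk)

theorem sum_le_mul_gammaMax : ∑ l, γ l ≤ (Function.support γ).ncard * gammaMax γ := by
  classical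
  have hfin : (Function.support γ).Finite := Set.toFinite _
  rw [← Finset.sum_subset (Finset.subset_univ hfin.toFinset) (fun l _ hl => by simpa using hl),
    Set.ncard_eq_toFinset_card _ hfin, ← nsmul_eq_mul]
  exact Finset.sum_le_card_nsmul _ _ _ fun l hl => le_gammaMax (by simpa using hl)

end Gamma

section StatMean

variable {D N : ℕ} {σ μ : ℝ} {γ : Fin N → ℝ} {a : Fin N → EuclideanSpace ℂ (Fin D)}

theorem le_statMean (hγ : ∀ k, 0 ≤ γ k) {k : Fin N} (hk : ‖a k‖ ^ 2 = D) :
    γ k * (D : ℝ) ^ 2 + σ ^ 2 * D ≤ statMean σ γ a k := by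
  rw [statMean, hk]
  gcongr
  have h := Finset.single_le_sum (f := fun l => γ l * ‖inner ℂ (a k) (a l)‖ ^ 2)
    (fun l _ => mul_nonneg (hγ l) (by positivity)) (Finset.mem_univ k)
  refine le_trans (le_of_eq ?_) h
  simp only [inner_self_eq_norm_sq_to_K]
  rw [← RCLike.ofReal_pow, hk]
  simp

/-- The own term `γ k * D²` occurs once per word, so its sum over `k` carries no factor `N`, unlike
cross terms and noise. -/
theorem sum_statMean_le (hγ : ∀ k, 0 ≤ γ k) (hμ : 0 ≤ μ)
    (ha : a ∈ incoherentCodebooks D N (Function.support γ) μ) :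
    ∑ k, statMean σ γ a k ≤
      N * (μ * ∑ l, γ l) + (D : ℝ) ^ 2 * ∑ l, γ l + N * (σ ^ 2 * D) := by
  obtain ⟨h1, h2⟩ := ha
  have h3 : ∀ k, statMean σ γ a k ≤ μ * ∑ l, γ l + γ k * (D : ℝ) ^ 2 + σ ^ 2 * D := by
    intro k
    rw [statMean, h1]
    gcongr
    rw [Finset.mul_sum, ← Finset.sum_erase_add _ _ (Finset.mem_univ k),
      ← Finset.sum_erase_add _ (fun l => μ * γ l) (Finset.mem_univ k)]
    have h4 : ‖inner ℂ (a k) (a k)‖ ^ 2 = (D : ℝ) ^ 2 := by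
      rw [inner_self_eq_norm_sq_to_K, ← RCLike.ofReal_pow, h1]
      simp
    rw [h4]
    have h5 : ∑ l ∈ Finset.univ.erase k, γ l * ‖inner ℂ (a k) (a l)‖ ^ 2 ≤
        ∑ l ∈ Finset.univ.erase k, μ * γ l := by
      refine Finset.sum_le_sum fun l hl => ?_
      by_cases hl0 : γ l = 0
      · simp [hl0]
      · rw [mul_comm]
        exact mul_le_mul_of_nonneg_right (h2 k l hl0 (Finset.ne_of_mem_erase hl).symm) (hγ l)
    have h6 : 0 ≤ μ * γ k := mul_nonneg hμ (hγ k)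
    linarith
  refine (Finset.sum_le_sum fun k _ => h3 k).trans (le_of_eq ?_)
  rw [Finset.sum_add_distrib, Finset.sum_add_distrib, ← Finset.sum_mul Finset.univ γ]
  simp only [Finset.sum_const, Finset.card_univ, Fintype.card_fin, nsmul_eq_mul]
  ring

end StatMean

/-! ### Numerical bounds and the main theorem. -/

theorem four_mul_sq_mul_exp_le {D N : ℕ} (hD : 0 < D) (hN : 0 < N) :
    4 * (N : ℝ) ^ 2 * Real.exp (-(12 * Real.log (D * N) / 4)) ≤ 4 / (D * Real.sqrt D) := by
  have hD1 : (1 : ℝ) ≤ D := by exact_mod_cast hD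
  have hN1 : (1 : ℝ) ≤ N := by exact_mod_cast hN
  have e : Real.exp (-(12 * Real.log (D * N) / 4)) = (((D : ℝ) * N) ^ 3)⁻¹ := by
    rw [Real.exp_neg]
    congr 1
    rw [show 12 * Real.log ((D : ℝ) * N) / 4 = (3 : ℕ) * Real.log ((D : ℝ) * N) by
      push_cast; ring, Real.exp_nat_mul, Real.exp_log (by positivity)]
  rw [e, ← div_eq_mul_inv, div_le_div_iff₀ (by positivity) (by positivity)]
  have h1 : Real.sqrt D ≤ D := by
    rw [Real.sqrt_le_left (by positivity)]
    nlinarith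
  have h2 : (D : ℝ) * Real.sqrt D ≤ D * D := mul_le_mul_of_nonneg_left h1 (by positivity)
  have h3 : (D : ℝ) * D ≤ D ^ 3 := by
    rw [← sq]
    exact pow_le_pow_right₀ hD1 (by norm_num)
  have h4 : (N : ℝ) ^ 2 ≤ N ^ 3 := pow_le_pow_right₀ hN1 (by norm_num)
  calc 4 * (N : ℝ) ^ 2 * (D * Real.sqrt D) ≤ 4 * (N : ℝ) ^ 3 * D ^ 3 := by
        refine mul_le_mul (by linarith) (h2.trans h3) (by positivity) (by positivity)
    _ = _ := by ring

/-- The claim amounts to `δ * (3/2 * g * d² + 2 * s * d) ≤ g * d² / 2`. Since `δ ≤ 1/8`, `δ * s ≤ g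
/ 8` and `d ≤ d²`, the left side is at most `7/16 * g * d²`. -/
theorem one_add_mul_le_one_sub_mul {g s d δ : ℝ} (hg : 0 < g) (hs : 0 ≤ s) (hd : 1 ≤ d)
    (hδ : δ = 1 / (8 * (1 + s / g))) :
    0 < δ ∧ δ ≤ 1 ∧ (1 + δ) * (g * d ^ 2 / 2 + s * d) ≤ (1 - δ) * (g * d ^ 2 + s * d) := by
  have hr : 0 ≤ s / g := by positivity
  have h0 : 0 < δ := by rw [hδ]; positivity
  have h1 : δ ≤ 1 / 8 := by
    rw [hδ, div_le_div_iff₀ (by positivity) (by norm_num)]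
    linarith
  have h2 : δ * s ≤ g / 8 := by
    have : δ * (8 * (1 + s / g)) = 1 := by
      rw [hδ]
      field_simp
    have h3 : δ * (8 * (g + s)) = g := by
      calc δ * (8 * (g + s)) = δ * (8 * (1 + s / g)) * g := by field_simp
        _ = g := by rw [this, one_mul]
    nlinarith [mul_pos h0 hg]
  refine ⟨h0, by linarith, ?_⟩
  have h4 : δ * s * d ≤ g / 8 * d := mul_le_mul_of_nonneg_right h2 (by linarith)
  have h5 : d ≤ d ^ 2 := by nlinarith
  have h6 : g * d ≤ g * d ^ 2 := mul_le_mul_of_nonneg_left h5 hg.le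
  have h7 : δ * (g * d ^ 2) ≤ 1 / 8 * (g * d ^ 2) := mul_le_mul_of_nonneg_right h1 (by positivity)
  nlinarith

/-- The constant `256 = 4 * 8²` cancels those in the exponent, so the exponential is at most `ε / (e
* D)²`, and `D + 1 ≤ (e * D)²` pays for the union bound. -/
theorem union_bound_le {c K x ε D : ℝ} {M : ℕ} (hD : 1 ≤ D) (hε : 0 < ε) (hε1 : ε < 1)
    (hc : c ≤ D) (hx : 1 ≤ x) (hxK : x ≤ K)
    (hM : (M : ℝ) ≥ 256 * K ^ 2 * Real.log ((Real.exp 1 * D) ^ 2 / ε)) :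
    (c + 1) * Real.exp (-(M * (1 / (8 * x)) ^ 2 / 4)) ≤ ε := by
  have he : 2 ≤ Real.exp 1 := by linarith [Real.add_one_le_exp (1 : ℝ)]
  have hA : 4 * D ^ 2 ≤ (Real.exp 1 * D) ^ 2 := by
    rw [mul_pow]
    exact mul_le_mul_of_nonneg_right (by nlinarith) (sq_nonneg D)
  have hq : 1 ≤ (Real.exp 1 * D) ^ 2 / ε := by
    rw [le_div_iff₀ hε]
    nlinarith
  have hlog : 0 ≤ Real.log ((Real.exp 1 * D) ^ 2 / ε) := Real.log_nonneg hq
  have h1 : Real.log ((Real.exp 1 * D) ^ 2 / ε) ≤ M * (1 / (8 * x)) ^ 2 / 4 := by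
    have hx2 : x ^ 2 ≤ K ^ 2 := pow_le_pow_left₀ (by linarith) hxK 2
    have h2 : 256 * x ^ 2 * Real.log ((Real.exp 1 * D) ^ 2 / ε) ≤ M :=
      le_trans (mul_le_mul_of_nonneg_right (by linarith) hlog) hM
    have e : (M : ℝ) * (1 / (8 * x)) ^ 2 / 4 = M / (256 * x ^ 2) := by
      field_simp
      ring
    rw [e, le_div_iff₀ (by positivity)]
    linarith
  have h3 : Real.exp (-(M * (1 / (8 * x)) ^ 2 / 4)) ≤ ε / (Real.exp 1 * D) ^ 2 := by
    calc _ ≤ Real.exp (-Real.log ((Real.exp 1 * D) ^ 2 / ε)) :=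
          Real.exp_le_exp.2 (neg_le_neg h1)
      _ = _ := by rw [Real.exp_neg, Real.exp_log (by positivity), inv_div]
  have h4 : (c + 1) * Real.exp (-(M * (1 / (8 * x)) ^ 2 / 4)) ≤
      (D + 1) * (ε / (Real.exp 1 * D) ^ 2) :=
    mul_le_mul (by linarith) h3 (Real.exp_pos _).le (by linarith)
  refine h4.trans ?_
  rw [mul_div_assoc', div_le_iff₀ (by positivity), mul_comm]
  exact mul_le_mul_of_nonneg_left (by nlinarith) hε.le

theorem theorem4 :
    ∃ c₀ c₄ c₆ c₇ : ℝ, 0 < c₀ ∧ 0 < c₄ ∧ 0 < c₆ ∧ 0 < c₇ ∧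
      ∀ (Ω : Type*) [MeasurableSpace Ω] (P : Measure Ω) [IsProbabilityMeasure P]
        (D N M K : ℕ) (_ : 0 < D) (_ : 0 < N) (_ : 0 < M)
        (σ ε : ℝ) (_ : 0 ≤ σ) (_ : 0 < ε)
        (γ : Fin N → ℝ) (_ : ∀ k, 0 ≤ γ k) (_ : (Function.support γ).ncard ≤ K)
        (a : Fin N → Ω → EuclideanSpace ℂ (Fin D)) (H : Fin N → Fin M → Ω → ℂ)
        (Z : Fin D → Fin M → Ω → ℂ) (_ : IsSparcModel P σ a H Z)
        (_ : (M : ℝ) ≥ c₄ * (dynRange γ * K + σ ^ 2 / gammaMin γ) ^ 2 *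
          Real.log ((Real.exp 1 * D) ^ 2 / ε))
        (_ : (K : ℝ) ≤ min (c₆ * D / (dynRange γ * Real.log (D * N))) (c₇ * N / dynRange γ)),
        P.real {ω | Function.support γ ⊆
            firstStageSet 1 (fun k => a k ω)
              (receivedSignal (fun k => a k ω) γ
                (Matrix.of fun k m => H k m ω) (Matrix.of fun i m => Z i m ω))}
          ≥ 1 - ε - c₀ / (D * Real.sqrt D) := by
  -- The `4` is that of the incoherence bound, `256` comes from `union_bound_le`, and `1 / 96 = 1 /
  -- (12 * 8)` and `1 / 8` make cross and own terms at most `γ_min * D² / 8` each.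
  refine ⟨4, 256, 1 / 96, 1 / 8, by norm_num, by norm_num, by norm_num, by norm_num, ?_⟩
  intro Ω _ P _ D N M K hD hN hM σ ε _ hε γ hγ hcard a H Z hmod hMbig hK
  have hD1 : (1 : ℝ) ≤ D := by exact_mod_cast hD
  have hN1 : (1 : ℝ) ≤ N := by exact_mod_cast hN
  have hcorr : 0 ≤ 4 / ((D : ℝ) * Real.sqrt D) := by positivity
  rcases (Function.support γ).eq_empty_or_nonempty with hemp | hne
  · simp only [hemp, Set.empty_subset, Set.ofPred_true, probReal_univ]
    linarith
  rcases le_or_gt 1 ε with hε1 | hε1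
  · exact le_trans (by linarith) measureReal_nonneg
  -- For `D = 1` the error term is `4`, so the claim is void. From `D ≥ 2` on, `log (D * N) ≥ 1 /
  -- 2`, which yields `K ≤ D` below.
  rcases (show D = 1 ∨ 2 ≤ D by omega) with rfl | hD2
  · exact le_trans (by norm_num; linarith) measureReal_nonneg
  have hD2' : (2 : ℝ) ≤ D := by exact_mod_cast hD2
  have hgmin := gammaMin_pos hγ hne
  obtain ⟨k₀, hk₀⟩ := hne
  have hgle : gammaMin γ ≤ gammaMax γ := (gammaMin_le hk₀).trans (le_gammaMax hk₀)
  have hdyn : 1 ≤ dynRange γ := by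
    rw [dynRange, le_div_iff₀ hgmin, one_mul]
    exact hgle
  have hK1 : (1 : ℝ) ≤ K := by
    have : 0 < (Function.support γ).ncard := (Set.ncard_pos (Set.toFinite _)).2 ⟨k₀, hk₀⟩
    exact_mod_cast this.trans_le hcard
  set ℓ : ℝ := Real.log (D * N) with hℓ
  have hℓ' : 1 / 2 ≤ ℓ := by
    have h1 : Real.log 2 ≤ ℓ := Real.log_le_log (by norm_num) (by nlinarith)
    linarith [Real.log_two_gt_d9]
  have hKD : K * dynRange γ * ℓ ≤ D / 96 := by
    have h := hK.trans (min_le_left _ _)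
    rw [le_div_iff₀ (by positivity)] at h
    linarith
  have hKN : K * dynRange γ ≤ N / 8 := by
    have h := hK.trans (min_le_right _ _)
    rw [le_div_iff₀ (by positivity)] at h
    linarith
  have hcK : ((Function.support γ).ncard : ℝ) ≤ K := by exact_mod_cast hcard
  have hsum : ∑ l, γ l ≤ K * dynRange γ * gammaMin γ := by
    rw [dynRange, mul_assoc, div_mul_cancel₀ _ hgmin.ne']
    exact sum_le_mul_gammaMax.trans (mul_le_mul_of_nonneg_right hcK (hgmin.le.trans hgle))
  have hKleD : (K : ℝ) ≤ D := by
    have h1 : (K : ℝ) ≤ K * dynRange γ := le_mul_of_one_le_right (by positivity) hdyn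
    have h2 : K * dynRange γ * (1 / 2) ≤ K * dynRange γ * ℓ :=
      mul_le_mul_of_nonneg_left hℓ' (by positivity)
    linarith
  set δ : ℝ := 1 / (8 * (1 + σ ^ 2 / gammaMin γ)) with hδ
  obtain ⟨hδ0, hδ1, hsep⟩ := one_add_mul_le_one_sub_mul hgmin (sq_nonneg σ) hD1 hδ
  set G := incoherentCodebooks D N (Function.support γ) (12 * ℓ * D) with hG
  have hfixed : ∀ b ∈ G, P.real {ω | ¬ Function.support γ ⊆ firstStageSet 1 b
      (receivedSignal b γ (Matrix.of fun k m => H k m ω) (Matrix.of fun i m => Z i m ω))} ≤ ε := by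
    intro b hb
    refine (measure_not_support_subset_le hM hN hmod.measurable_H hmod.measurable_Z hmod.law_H
      hmod.law_Z hmod.indep_HZ hγ b hδ0.le hδ1 (by positivity) (fun k hk => ?_) ?_ hsep).trans ?_
    · refine le_trans ?_ (le_statMean hγ (hb.1 k))
      have := gammaMin_le hk
      gcongr
    · refine (sum_statMean_le hγ (by positivity) hb).trans_lt ?_
      -- Own and cross terms together use `γ_min * D² / 4` of the allowed `γ_min * D² / 2`, which
      -- makes the inequality strict.
      have h1 : (D : ℝ) ^ 2 * ∑ l, γ l ≤ N * (gammaMin γ * D ^ 2 / 8) := by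
        calc (D : ℝ) ^ 2 * ∑ l, γ l ≤ D ^ 2 * (N / 8 * gammaMin γ) := by
              gcongr
              exact hsum.trans (mul_le_mul_of_nonneg_right hKN hgmin.le)
          _ = _ := by ring
      have h2 : 12 * ℓ * D * ∑ l, γ l ≤ gammaMin γ * D ^ 2 / 8 := by
        calc 12 * ℓ * D * ∑ l, γ l ≤ 12 * ℓ * D * (K * dynRange γ * gammaMin γ) := by gcongr
          _ = 12 * D * gammaMin γ * (K * dynRange γ * ℓ) := by ring
          _ ≤ 12 * D * gammaMin γ * (D / 96) := by gcongr
          _ = _ := by ring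
      have h3 : N * (12 * ℓ * D * ∑ l, γ l) ≤ N * (gammaMin γ * D ^ 2 / 8) := by gcongr
      have h4 : 0 < N * (gammaMin γ * (D : ℝ) ^ 2) := by positivity
      linarith
    · refine union_bound_le hD1 hε hε1 (hcK.trans hKleD) ?_ ?_ hMbig
      · have : 0 ≤ σ ^ 2 / gammaMin γ := by positivity
        linarith
      · have : 1 ≤ dynRange γ * K := one_le_mul_of_one_le_of_one_le hdyn hK1
        linarith
  set S : Set ((Fin N → EuclideanSpace ℂ (Fin D)) ×
      ((Fin N → Fin M → ℂ) × (Fin D → Fin M → ℂ))) :=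
    {p | ¬ Function.support γ ⊆ firstStageSet 1 p.1
      (receivedSignal p.1 γ (Matrix.of p.2.1) (Matrix.of p.2.2))} with hSdef
  have hS : MeasurableSet S := by
    have : Sᶜ = ⋂ k, ⋂ (_ : k ∈ Function.support γ), {p |
        1 * ((1 / (N : ℝ)) * ∑ i,
          stat p.1 (receivedSignal p.1 γ (Matrix.of p.2.1) (Matrix.of p.2.2)) i) <
        stat p.1 (receivedSignal p.1 γ (Matrix.of p.2.1) (Matrix.of p.2.2)) k} := by
      ext p
      simp [hSdef, Set.subset_def, firstStageSet]
    rw [← MeasurableSet.compl_iff, this]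
    refine MeasurableSet.iInter fun k => MeasurableSet.iInter fun _ => measurableSet_lt ?_
      (measurable_stat_receivedSignal γ k)
    exact ((Finset.measurable_sum _ fun i _ =>
      measurable_stat_receivedSignal γ i).const_mul _).const_mul _
  have hX : Measurable fun ω k => a k ω := measurable_pi_lambda _ hmod.measurable_a
  have hY : Measurable fun ω => ((fun k m => H k m ω : Fin N → Fin M → ℂ),
      (fun i m => Z i m ω : Fin D → Fin M → ℂ)) := by
    have := hmod.measurable_H
    have := hmod.measurable_Z
    fun_prop
  have hbad := measure_and_le_of_indepFun hX hY hmod.indep_a_HZ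
    (measurableSet_incoherentCodebooks D N (Function.support γ) (12 * ℓ * D)) hS hε.le hfixed
  have hcode := (measure_not_incoherentCodebooks_le hD hmod.measurable_a hmod.law_a hmod.indep_a
    (Function.support γ) (12 * ℓ)).trans (four_mul_sq_mul_exp_le hD hN)
  set T := {ω | Function.support γ ⊆ firstStageSet 1 (fun k => a k ω)
    (receivedSignal (fun k => a k ω) γ
      (Matrix.of fun k m => H k m ω) (Matrix.of fun i m => Z i m ω))} with hT
  set B₁ := {ω | (fun k => a k ω) ∈ G ∧ ((fun k => a k ω),
    ((fun k m => H k m ω : Fin N → Fin M → ℂ), (fun i m => Z i m ω : Fin D → Fin M → ℂ))) ∈ S}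
  set B₂ := {ω | (fun k => a k ω) ∉ G}
  have hcover : Set.univ ⊆ T ∪ (B₁ ∪ B₂) := by
    intro ω _
    by_cases h1 : ω ∈ T
    · exact Or.inl h1
    · by_cases h2 : (fun k => a k ω) ∈ G
      · exact Or.inr (Or.inl ⟨h2, h1⟩)
      · exact Or.inr (Or.inr h2)
  have h1 : (1 : ℝ) ≤ P.real T + (P.real B₁ + P.real B₂) := by
    have h2 := measureReal_mono (μ := P) hcover
    rw [probReal_univ] at h2
    have h3 := measureReal_union_le (μ := P) T (B₁ ∪ B₂)
    have h4 := measureReal_union_le (μ := P) B₁ B₂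
    linarith
  linarith
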